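/- Let $n\ge 4$ be an even integer, let $u\in C^\infty(\mathbb{R}^n)$ be real valued, and let $g=e^{2u}|dx|^2$ be the corresponding conformal metric on $\mathbb{R}^n$ (not assumed complete). Let $R_g$ be its scalar curvature, and let $Q$ be its Q-curvature, i.e. the function determined by $$(-\Delta)^{n/2}u=Q\,e^{nu}\qquad\text{on }\mathbb{R}^n ,$$ where $\Delta$ is the Euclidean Laplacian. Assume that $g$ has finite total Q-curvature, that is, $Qe^{nu}\in L^1(\mathbb{R}^n)$. Write $R_g^-=\max\{-R_g,0\}$ and let $|\mathbb{S}^n|$ be the volume of the standard unit $n$-sphere in $\mathbb{R}^{n+1}$. 1. If $\int_{\mathbb{R}^n}(R_g^-)^{n/2}e^{nu}\,dx<+\infty$, then $$0\le\int_{\mathbb{R}^n}Qe^{nu}\,dx\le (n-1)!\,|\mathbb{S}^n| .$$ 2. If $\int_{\mathbb{R}^n}|R_g|^{n/2}e^{nu}\,dx<+\infty$, then $$\int_{\mathbb{R}^n}Qe^{nu}\,dx=0\quad\text{or}\quad\int_{\mathbb{R}^n}Qe^{nu}\,dx=(n-1)!\,|\mathbb{S}^n| .$$ If in addition the volume is finite,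 i.e. $e^{nu}\in L^1(\mathbb{R}^n)$, then $$\int_{\mathbb{R}^n}Qe^{nu}\,dx=(n-1)!\,|\mathbb{S}^n| .$$ -/

import Mathlib

open MeasureTheory
open scoped ContDiff Laplacian

noncomputable section

namespace ConformalQ

/-- The `i`-th partial derivative of a real function on `ℝⁿ`. -/
def partialDeriv {n : ℕ} (i : Fin n) (f : EuclideanSpace ℝ (Fin n) → ℝ)
    (x : EuclideanSpace ℝ (Fin n)) : ℝ :=
  fderiv ℝ f x (EuclideanSpace.single i 1)

/-- The Christoffel symbol `Γᵏᵢⱼ = ½ ∑ₗ gᵏˡ (∂ᵢ gⱼₗ + ∂ⱼ gᵢₗ - ∂ₗ gᵢⱼ)` of a metric `g` on `ℝⁿ`,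
given by its matrix in the standard coordinates. -/
def christoffel {n : ℕ} (g : EuclideanSpace ℝ (Fin n) → Matrix (Fin n) (Fin n) ℝ)
    (k i j : Fin n) (x : EuclideanSpace ℝ (Fin n)) : ℝ :=
  (1 / 2) * ∑ l, (g x)⁻¹ k l *
    (partialDeriv i (fun y => g y j l) x + partialDeriv j (fun y => g y i l) x
      - partialDeriv l (fun y => g y i j) x)

/-- The Ricci curvature
`Rᵢⱼ = ∑ₖ (∂ₖ Γᵏᵢⱼ - ∂ⱼ Γᵏᵢₖ + ∑ₗ (Γᵏₖₗ Γˡᵢⱼ - Γᵏⱼₗ Γˡᵢₖ))`. -/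
def ricci {n : ℕ} (g : EuclideanSpace ℝ (Fin n) → Matrix (Fin n) (Fin n) ℝ)
    (i j : Fin n) (x : EuclideanSpace ℝ (Fin n)) : ℝ :=
  ∑ k, (partialDeriv k (christoffel g k i j) x - partialDeriv j (christoffel g k i k) x
    + ∑ l, (christoffel g k k l x * christoffel g l i j x
      - christoffel g k j l x * christoffel g l i k x))

/-- The scalar curvature `R_g = ∑ᵢⱼ gⁱʲ Rᵢⱼ` (positive for round spheres). -/
def scalarCurvature {n : ℕ} (g : EuclideanSpace ℝ (Fin n) → Matrix (Fin n) (Fin n) ℝ)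
    (x : EuclideanSpace ℝ (Fin n)) : ℝ :=
  ∑ i, ∑ j, (g x)⁻¹ i j * ricci g i j x

/-- The conformally flat metric `g = e^{2u} |dx|²` on `ℝⁿ`. -/
def conformalMetric {n : ℕ} (u : EuclideanSpace ℝ (Fin n) → ℝ)
    (x : EuclideanSpace ℝ (Fin n)) : Matrix (Fin n) (Fin n) ℝ :=
  Real.exp (2 * u x) • (1 : Matrix (Fin n) (Fin n) ℝ)

/-- The Q-curvature of `g = e^{2u} |dx|²` on `ℝⁿ`, `n` even: the function `Q` determined by
the conformally invariant equation `(-Δ)^{n/2} u = Q e^{nu}`, where `Δ` is the Euclidean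
Laplacian and `(-Δ)^{n/2}` is the `n/2`-th iterate of `-Δ`. -/
def qCurvature {n : ℕ} (u : EuclideanSpace ℝ (Fin n) → ℝ)
    (x : EuclideanSpace ℝ (Fin n)) : ℝ :=
  ((fun f : EuclideanSpace ℝ (Fin n) → ℝ => -(Δ f))^[n / 2] u) x * Real.exp (-(n * u x))

/-- The volume `|𝕊ⁿ|` of the unit sphere of `ℝⁿ⁺¹` for its standard surface measure. -/
def sphereVolume (n : ℕ) : ℝ :=
  (volume : Measure (EuclideanSpace ℝ (Fin (n + 1)))).toSphere.real Set.univ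

end ConformalQ

end

/-! Write n = 2m with m = l + 2, f = (-Δ)^m u, Λ = ∫ f, κ = (n-1)! |𝕊ⁿ| / 2 and α = Λ/κ. Seen from
infinity, u behaves like -α log |x|, and the scalar curvature of that model has the sign of -α(α -
2). The curvature hypotheses forbid the wrong sign at infinity, so 0 ≤ α ≤ 2 in the one-sided case
and α ∈ {0, 2} in the two-sided one.

The conformal formula `scalarCurvature_conformalMetric` gives R_g = -2(n-1) e^{-2u} K with K = Δu +
(n-2)/2 |∇u|² (`confLap`). Hence the hypotheses say that K⁺ or |K| lies in L^{n/2}(dx), a norm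
invariant under u ↦ u(x + R·). Testing K ≤ K⁺ with a squared cutoff (`exists_caccioppoli`) bounds
the gradients of all rescalings in L²(B₂).

This bound rules out a polyharmonic polynomial part of u at the level of gradients:
`gradient_representation` states κ ∂ᵢu(x) = ∫ (y-x)ᵢ/|y-x|² f(y) dy. It comes from pairing f with
derivatives of a smooth difference of two truncated logarithms at scales t and 1/t; the small scale
produces κ ∂ᵢu(x) because (-Δ)^m(-log |x|) = κδ, and the large scale disappears by the gradient
bound.

From the representation, R∇u(Rξ) → -αξ/|ξ|² in L² of the annulus 1 ≤ |ξ| ≤ 2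
(`tendsto_integral_sq_deviation`). Only L² convergence of first derivatives is needed: against a
bump ψ, after one integration by parts, ∫ ψ K(u_R) converges to (m-1) α(α-2) ∫ ψ/|ξ|²
(`AnnularBump.tendsto_integral_confLap`), while the scale-invariant L^{n/2} mass over the dilated
annuli tends to 0. Comparing the limits gives `mul_sub_two_nonpos` and `mul_sub_two_eq_zero`.

If α = 0, bump averages of u over dilated annuli decrease more slowly than (1/2) log R; by Jensen
the volume is then infinite (`not_integrable_exp`), so finite volume leaves α = 2. -/

namespace ConformalQ

open Filter Topology Set

/-! ### Coordinate derivatives, integration by parts and rescaling -/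

section Calculus

variable {n : ℕ} {f g u φ : EuclideanSpace ℝ (Fin n) → ℝ}

theorem smooth_partialDeriv (hf : ContDiff ℝ ∞ f) (i : Fin n) :
    ContDiff ℝ ∞ (partialDeriv i f) := by
  unfold partialDeriv
  exact (hf.fderiv_right (m := ∞) (by simp)).clm_apply contDiff_const

theorem partialDeriv_partialDeriv (hf : ContDiff ℝ ∞ f) (i j : Fin n)
    (x : EuclideanSpace ℝ (Fin n)) :
    partialDeriv i (partialDeriv j f) x =
      fderiv ℝ (fderiv ℝ f) x (EuclideanSpace.single i 1) (EuclideanSpace.single j 1) := by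
  have h : DifferentiableAt ℝ (fderiv ℝ f) x :=
    ((hf.fderiv_right (m := ∞) (by simp)).differentiable (by simp)).differentiableAt
  unfold partialDeriv
  rw [fderiv_clm_apply h (differentiableAt_const _)]
  simp

theorem partialDeriv_comm (hf : ContDiff ℝ ∞ f) (i j : Fin n) :
    partialDeriv i (partialDeriv j f) = partialDeriv j (partialDeriv i f) := by
  ext x
  rw [partialDeriv_partialDeriv hf, partialDeriv_partialDeriv hf]
  exact (hf.contDiffAt.isSymmSndFDerivAt (by simp; exact WithTop.coe_le_coe.2 le_top)) _ _

theorem laplacian_eq_sum (hf : ContDiff ℝ ∞ f) :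
    Δ f = fun x => ∑ i, partialDeriv i (partialDeriv i f) x := by
  rw [InnerProductSpace.laplacian_eq_iteratedFDeriv_orthonormalBasis f
    (EuclideanSpace.basisFun (Fin n) ℝ)]
  ext x
  refine Finset.sum_congr rfl fun i _ => ?_
  rw [partialDeriv_partialDeriv hf, iteratedFDeriv_two_apply]
  simp

theorem smooth_laplacian (hf : ContDiff ℝ ∞ f) : ContDiff ℝ ∞ (Δ f) := by
  rw [laplacian_eq_sum hf]
  exact ContDiff.sum fun i _ =>
    smooth_partialDeriv (smooth_partialDeriv hf i) i

theorem partialDeriv_hasCompactSupport (hf : HasCompactSupport f) (i : Fin n) :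
    HasCompactSupport (partialDeriv i f) := by
  exact (hf.fderiv (𝕜 := ℝ)).comp_left (g := fun L : EuclideanSpace ℝ (Fin n) →L[ℝ] ℝ =>
    L (EuclideanSpace.single i 1)) (by simp)

theorem laplacian_hasCompactSupport (hs : HasCompactSupport f) :
    HasCompactSupport (Δ f) := by
  refine hs.mono' ?_
  intro x hx
  by_contra hx'
  apply hx
  have h0 : f =ᶠ[𝓝 x] fun _ => (0 : ℝ) := notMem_tsupport_iff_eventuallyEq.1 hx'
  have := InnerProductSpace.laplacian_congr_nhds h0
  rw [this.eq_of_nhds]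
  simp

/-- The iterates of `-Δ`. -/
noncomputable def iterLap (k : ℕ) (f : EuclideanSpace ℝ (Fin n) → ℝ) : EuclideanSpace ℝ (Fin n) → ℝ :=
  (fun f : EuclideanSpace ℝ (Fin n) → ℝ => -(Δ f))^[k] f

@[simp] theorem iterLap_zero : iterLap 0 f = f := rfl

theorem iterLap_succ (k : ℕ) : iterLap (k + 1) f = iterLap k (-(Δ f)) := rfl

theorem iterLap_succ' (k : ℕ) : iterLap (k + 1) f = -(Δ (iterLap k f)) :=
  Function.iterate_succ_apply' _ _ _

theorem iterLap_smooth (hf : ContDiff ℝ ∞ f) (k : ℕ) : ContDiff ℝ ∞ (iterLap k f) := by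
  induction k with
  | zero => exact hf
  | succ k ih => rw [iterLap_succ']; exact (smooth_laplacian ih).neg

theorem iterLap_hasCompactSupport (hs : HasCompactSupport f) (k : ℕ) :
    HasCompactSupport (iterLap k f) := by
  induction k with
  | zero => exact hs
  | succ k ih =>
    rw [iterLap_succ']
    exact (laplacian_hasCompactSupport ih).neg

theorem partialDeriv_neg (i : Fin n) : partialDeriv i (-f) = -partialDeriv i f := by
  ext x
  simp [partialDeriv, fderiv_neg]

theorem partialDeriv_sum {ι : Type*} (s : Finset ι) {F : ι → EuclideanSpace ℝ (Fin n) → ℝ}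
    (hF : ∀ j, ContDiff ℝ ∞ (F j)) (i : Fin n) :
    partialDeriv i (fun x => ∑ j ∈ s, F j x) = fun x => ∑ j ∈ s, partialDeriv i (F j) x := by
  ext x
  simp only [partialDeriv]
  rw [fderiv_fun_sum fun j _ => ((hF j).differentiable (by simp)) x]
  simp

theorem partialDeriv_mul (hf : Differentiable ℝ f) (hg : Differentiable ℝ g) (i : Fin n)
    (x : EuclideanSpace ℝ (Fin n)) :
    partialDeriv i (fun x => f x * g x) x =
      f x * partialDeriv i g x + partialDeriv i f x * g x := by
  simp only [partialDeriv]
  rw [fderiv_fun_mul (hf x) (hg x)]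
  simp [mul_comm]

theorem partialDeriv_laplacian (hf : ContDiff ℝ ∞ f) (i : Fin n) :
    partialDeriv i (Δ f) = Δ (partialDeriv i f) := by
  rw [laplacian_eq_sum hf, laplacian_eq_sum (smooth_partialDeriv hf i),
    partialDeriv_sum _ fun j => smooth_partialDeriv (smooth_partialDeriv hf j) j]
  ext x
  refine Finset.sum_congr rfl fun j _ => ?_
  rw [partialDeriv_comm (smooth_partialDeriv hf j) i j, partialDeriv_comm hf i j]

theorem partialDeriv_iterLap (hf : ContDiff ℝ ∞ f) (i : Fin n) (k : ℕ) :
    partialDeriv i (iterLap k f) = iterLap k (partialDeriv i f) := by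
  induction k with
  | zero => rfl
  | succ k ih =>
    rw [iterLap_succ', iterLap_succ', partialDeriv_neg,
      partialDeriv_laplacian (iterLap_smooth hf k), ih]

theorem integral_mul_partialDeriv (hφ : ContDiff ℝ ∞ φ) (hs : HasCompactSupport φ)
    (hu : ContDiff ℝ ∞ u) (i : Fin n) :
    ∫ x, φ x * partialDeriv i u x = -∫ x, partialDeriv i φ x * u x := by
  have hc := hφ.continuous
  have hcu := hu.continuous
  have h1 := (smooth_partialDeriv hφ i).continuous
  have h2 := (smooth_partialDeriv hu i).continuous
  refine integral_mul_fderiv_eq_neg_fderiv_mul_of_integrable ?_ ?_ ?_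
    (fun x _ => hφ.differentiable (by simp) x) (fun x _ => hu.differentiable (by simp) x)
  · exact (h1.mul hcu).integrable_of_hasCompactSupport
      ((partialDeriv_hasCompactSupport hs i).mul_right)
  · exact (hc.mul h2).integrable_of_hasCompactSupport hs.mul_right
  · exact (hc.mul hcu).integrable_of_hasCompactSupport hs.mul_right

theorem integral_mul_laplacian (hφ : ContDiff ℝ ∞ φ) (hs : HasCompactSupport φ)
    (hu : ContDiff ℝ ∞ u) :
    ∫ x, φ x * Δ u x = -∑ i, ∫ x, partialDeriv i φ x * partialDeriv i u x := by
  rw [laplacian_eq_sum hu]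
  simp only [Finset.mul_sum]
  rw [integral_finsetSum, ← Finset.sum_neg_distrib]
  · exact Finset.sum_congr rfl fun i _ =>
      integral_mul_partialDeriv hφ hs (smooth_partialDeriv hu i) i
  · intro i _
    exact (hφ.continuous.mul (smooth_partialDeriv
      (smooth_partialDeriv hu i) i).continuous).integrable_of_hasCompactSupport
      hs.mul_right

theorem integral_mul_laplacian_comm (hφ : ContDiff ℝ ∞ φ) (hs : HasCompactSupport φ)
    (hu : ContDiff ℝ ∞ u) : ∫ x, φ x * Δ u x = ∫ x, Δ φ x * u x := by
  rw [integral_mul_laplacian hφ hs hu, laplacian_eq_sum hφ]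
  simp only [Finset.sum_mul]
  rw [integral_finsetSum, ← Finset.sum_neg_distrib]
  · refine Finset.sum_congr rfl fun i _ => ?_
    rw [integral_mul_partialDeriv (smooth_partialDeriv hφ i)
      (partialDeriv_hasCompactSupport hs i) hu i, neg_neg]
  · intro i _
    exact ((smooth_partialDeriv
      (smooth_partialDeriv hφ i) i).continuous.mul
        hu.continuous).integrable_of_hasCompactSupport
      (partialDeriv_hasCompactSupport (partialDeriv_hasCompactSupport hs i) i).mul_right

theorem integral_mul_iterLap (hφ : ContDiff ℝ ∞ φ) (hs : HasCompactSupport φ)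
    (hu : ContDiff ℝ ∞ u) (k : ℕ) :
    ∫ x, φ x * iterLap k u x = ∫ x, iterLap k φ x * u x := by
  induction k generalizing u with
  | zero => rfl
  | succ k ih =>
    rw [iterLap_succ, ih (u := -(Δ u)) (smooth_laplacian hu).neg, iterLap_succ']
    have := integral_mul_laplacian_comm (iterLap_smooth hφ k)
      (iterLap_hasCompactSupport hs k) hu
    simp only [Pi.neg_apply, mul_neg, neg_mul, integral_neg, this]

/-- All but one derivative is moved to the test function: f keeps its L¹ role on one side, and only
∇u, which the energy bound controls, remains on the other. -/
theorem integral_partialDeriv_mul_iterLap (hφ : ContDiff ℝ ∞ φ) (hs : HasCompactSupport φ)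
    (hu : ContDiff ℝ ∞ u) (k : ℕ) (i : Fin n) :
    ∫ x, partialDeriv i φ x * iterLap k u x = -∫ x, iterLap k φ x * partialDeriv i u x := by
  rw [integral_mul_iterLap (smooth_partialDeriv hφ i)
    (partialDeriv_hasCompactSupport hs i) hu, ← partialDeriv_iterLap hφ,
    integral_mul_partialDeriv (iterLap_smooth hφ k) (iterLap_hasCompactSupport hs k) hu,
    neg_neg]

/-- The rescaling `z ↦ u (x + R z)`. -/
def rescale (u : EuclideanSpace ℝ (Fin n) → ℝ) (x : EuclideanSpace ℝ (Fin n)) (R : ℝ)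
    (z : EuclideanSpace ℝ (Fin n)) : ℝ := u (x + R • z)

theorem rescale_smooth (hu : ContDiff ℝ ∞ u) (x : EuclideanSpace ℝ (Fin n)) (R : ℝ) :
    ContDiff ℝ ∞ (rescale u x R) := by
  unfold rescale
  fun_prop

theorem partialDeriv_rescale (hu : ContDiff ℝ ∞ u) (x : EuclideanSpace ℝ (Fin n)) (R : ℝ)
    (i : Fin n) (z : EuclideanSpace ℝ (Fin n)) :
    partialDeriv i (rescale u x R) z = R * partialDeriv i u (x + R • z) := by
  have h1 : HasFDerivAt (fun z : EuclideanSpace ℝ (Fin n) => x + R • z)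
      (R • ContinuousLinearMap.id ℝ (EuclideanSpace ℝ (Fin n))) z :=
    ((hasFDerivAt_id z).const_smul R).const_add x
  have h2 := ((hu.differentiable (by simp)) (x + R • z)).hasFDerivAt
  have h3 : HasFDerivAt (rescale u x R) _ z := h2.comp z h1
  unfold partialDeriv
  rw [h3.fderiv]
  simp

theorem laplacian_rescale (hu : ContDiff ℝ ∞ u) (x : EuclideanSpace ℝ (Fin n)) (R : ℝ)
    (z : EuclideanSpace ℝ (Fin n)) :
    Δ (rescale u x R) z = R ^ 2 * Δ u (x + R • z) := by
  rw [laplacian_eq_sum (rescale_smooth hu x R), laplacian_eq_sum hu]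
  simp only [Finset.mul_sum]
  refine Finset.sum_congr rfl fun i _ => ?_
  have h : partialDeriv i (rescale u x R) =
      fun z => R * rescale (partialDeriv i u) x R z :=
    funext fun z => partialDeriv_rescale hu x R i z
  rw [h]
  have h3 := partialDeriv_rescale (smooth_partialDeriv hu i) x R i z
  have h4 : partialDeriv i (fun z => R * rescale (partialDeriv i u) x R z) z =
      R * partialDeriv i (rescale (partialDeriv i u) x R) z := by
    change fderiv ℝ _ z _ = R * fderiv ℝ _ z _
    rw [fderiv_const_mul ((rescale_smooth (smooth_partialDeriv hu i) x R).differentiable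
      (by simp) z)]
    rfl
  rw [h4, h3]
  ring

theorem iterLap_translate (hu : ContDiff ℝ ∞ u) (x : EuclideanSpace ℝ (Fin n)) (k : ℕ) :
    iterLap k (rescale u x 1) = rescale (iterLap k u) x 1 := by
  induction k with
  | zero => rfl
  | succ k ih =>
    rw [iterLap_succ', iterLap_succ', ih]
    ext z
    rw [Pi.neg_apply, laplacian_rescale (iterLap_smooth hu k)]
    simp [rescale]

end Calculus

/-! ### Scalar curvature of a conformally flat metric -/

section Curvature

variable {n : ℕ} {u : EuclideanSpace ℝ (Fin n) → ℝ}

theorem conformalMetric_inv_apply (x : EuclideanSpace ℝ (Fin n)) (i j : Fin n) :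
    (conformalMetric u x)⁻¹ i j = if i = j then Real.exp (-(2 * u x)) else 0 := by
  have h : (conformalMetric u x)⁻¹ = Real.exp (-(2 * u x)) • (1 : Matrix (Fin n) (Fin n) ℝ) := by
    refine Matrix.inv_eq_left_inv ?_
    rw [conformalMetric, smul_mul_smul_comm, ← Real.exp_add]
    simp
  rw [h, Matrix.smul_apply, Matrix.one_apply]
  split_ifs <;> simp

theorem partialDeriv_conformalMetric (hu : ContDiff ℝ ∞ u) (x : EuclideanSpace ℝ (Fin n))
    (i j l : Fin n) :
    partialDeriv i (fun y => conformalMetric u y j l) x =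
      if j = l then 2 * partialDeriv i u x * Real.exp (2 * u x) else 0 := by
  by_cases h : j = l
  · subst h
    have h1 := ((((hu.differentiable (by simp)) x).hasFDerivAt).const_mul 2).exp
    have h2 : (fun y => conformalMetric u y j j) = fun y => Real.exp (2 * u y) := by
      ext y
      simp [conformalMetric]
    rw [h2]
    unfold partialDeriv
    rw [h1.fderiv]
    simp
    ring
  · have h2 : (fun y => conformalMetric u y j l) = fun y => 0 := by
      ext y
      simp [conformalMetric, h]
    rw [h2]
    simp [partialDeriv, h]

theorem christoffel_conformalMetric (hu : ContDiff ℝ ∞ u) (k i j : Fin n) :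
    christoffel (conformalMetric u) k i j =
      (fun x => (if j = k then partialDeriv i u x else 0)
        + (if i = k then partialDeriv j u x else 0)
        - (if i = j then partialDeriv k u x else 0)) := by
  ext x
  have he : Real.exp (-(2 * u x)) * Real.exp (2 * u x) = 1 := by
    rw [← Real.exp_add]; simp
  unfold christoffel
  simp only [conformalMetric_inv_apply, partialDeriv_conformalMetric hu, ite_mul, zero_mul,
    Finset.sum_ite_eq, Finset.mem_univ, if_true]
  have hi : ∀ (p : Prop) [Decidable p] (a : ℝ), (if p then 2 * a * Real.exp (2 * u x) else 0) =
      2 * Real.exp (2 * u x) * (if p then a else 0) := by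
    intro p _ a
    split_ifs <;> ring
  simp only [hi]
  linear_combination ((if j = k then partialDeriv i u x else 0)
        + (if i = k then partialDeriv j u x else 0)
        - (if i = j then partialDeriv k u x else 0)) * he

theorem partialDeriv_christoffel (hu : ContDiff ℝ ∞ u) (l k i j : Fin n)
    (x : EuclideanSpace ℝ (Fin n)) :
    partialDeriv l (christoffel (conformalMetric u) k i j) x =
      (if j = k then partialDeriv l (partialDeriv i u) x else 0)
        + (if i = k then partialDeriv l (partialDeriv j u) x else 0)
        - (if i = j then partialDeriv l (partialDeriv k u) x else 0) := by
  have h : ∀ (p : Prop) [Decidable p] (a : Fin n),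
      HasFDerivAt (fun x => if p then partialDeriv a u x else 0)
        (if p then fderiv ℝ (partialDeriv a u) x else 0) x := by
    intro p _ a
    split_ifs
    · exact ((smooth_partialDeriv hu a).differentiable (by simp) x).hasFDerivAt
    · exact hasFDerivAt_const _ _
  rw [christoffel_conformalMetric hu]
  have := (((h (j = k) i).add (h (i = k) j)).sub (h (i = j) k)).fderiv
  unfold partialDeriv at this ⊢
  erw [this]
  split_ifs <;> simp

/-- Diagonal entries suffice because the inverse metric is diagonal. -/
theorem ricci_conformalMetric_diag (hu : ContDiff ℝ ∞ u) (i : Fin n)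
    (x : EuclideanSpace ℝ (Fin n)) :
    ricci (conformalMetric u) i i x =
      (2 - n) * partialDeriv i (partialDeriv i u) x
        - ∑ k, partialDeriv k (partialDeriv k u) x
        + (n - 2) * (partialDeriv i u x) ^ 2 + (2 - n) * ∑ k, (partialDeriv k u x) ^ 2 := by
  -- Each coincidence among the indices is recorded as a separate indicator, so that the double sum
  -- collapses term by term.
  have hq : ∀ k l : Fin n,
      christoffel (conformalMetric u) k k l x * christoffel (conformalMetric u) l i i x
      - christoffel (conformalMetric u) k i l x * christoffel (conformalMetric u) l i k x =
      ((if l = i then 2 * (partialDeriv i u x) ^ 2 else 0) - (partialDeriv l u x) ^ 2)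
      - ((if l = k then (partialDeriv i u x) ^ 2 else 0)
        - (if k = i then (partialDeriv l u x) ^ 2 else 0)
        - (if l = i then (partialDeriv k u x) ^ 2 else 0)
        + (if l = i then (if k = i then 2 * (partialDeriv i u x) ^ 2 else 0) else 0)) := by
    intro k l
    simp only [christoffel_conformalMetric hu]
    by_cases h1 : k = i <;> by_cases h2 : l = i <;> by_cases h3 : l = k <;>
      simp_all [eq_comm] <;> ring
  have hd : ∀ k : Fin n, partialDeriv k (christoffel (conformalMetric u) k i i) x
      - partialDeriv i (christoffel (conformalMetric u) k i k) x =
      (if k = i then 2 * partialDeriv i (partialDeriv i u) x else 0)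
        - partialDeriv k (partialDeriv k u) x - partialDeriv i (partialDeriv i u) x := by
    intro k
    simp only [partialDeriv_christoffel hu]
    by_cases h1 : k = i <;> simp_all [eq_comm]
    ring
  unfold ricci
  simp only [hq, hd]
  simp only [Finset.sum_add_distrib, Finset.sum_sub_distrib, Finset.sum_ite_eq',
    Finset.mem_univ, if_true, Finset.sum_const, Finset.card_univ, Fintype.card_fin, nsmul_eq_mul]
  have h5 : ∑ k : Fin n, ∑ l : Fin n, (if k = i then (partialDeriv l u x) ^ 2 else 0) =
      ∑ l, (partialDeriv l u x) ^ 2 := by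
    rw [Finset.sum_comm]
    simp
  rw [h5]
  ring

theorem scalarCurvature_conformalMetric (hu : ContDiff ℝ ∞ u) (x : EuclideanSpace ℝ (Fin n)) :
    scalarCurvature (conformalMetric u) x =
      -(2 * (n - 1)) * Real.exp (-(2 * u x)) *
        (Δ u x + (n - 2) / 2 * ∑ i, (partialDeriv i u x) ^ 2) := by
  unfold scalarCurvature
  simp only [conformalMetric_inv_apply, ite_mul, zero_mul, Finset.sum_ite_eq, Finset.mem_univ,
    if_true, ricci_conformalMetric_diag hu, ← Finset.mul_sum, Finset.sum_add_distrib,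
    Finset.sum_sub_distrib, Finset.sum_const, Finset.card_univ, Fintype.card_fin, nsmul_eq_mul]
  rw [laplacian_eq_sum hu]
  ring

end Curvature

/-! ### Radial functions in the variable s = ‖z‖² -/

section Radial

variable {n : ℕ}

/-- The radial function `z ↦ g (‖z‖²)`. -/
noncomputable def radial (n : ℕ) (g : ℝ → ℝ) (z : EuclideanSpace ℝ (Fin n)) : ℝ := g (‖z‖ ^ 2)

/-- The operator `D` with `Δ (g (‖z‖²)) = (D g) (‖z‖²)`. -/
noncomputable def radOp (n : ℕ) (g : ℝ → ℝ) (s : ℝ) : ℝ :=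
  4 * s * deriv (deriv g) s + 2 * n * deriv g s

/-- The iterates of `-D`. -/
noncomputable def radIter (n k : ℕ) (g : ℝ → ℝ) : ℝ → ℝ := (fun g => -(radOp n g))^[k] g

theorem radIter_succ (k : ℕ) (g : ℝ → ℝ) : radIter n (k + 1) g = -(radOp n (radIter n k g)) :=
  Function.iterate_succ_apply' _ _ _

theorem smooth_deriv {g : ℝ → ℝ} (hg : ContDiff ℝ ∞ g) : ContDiff ℝ ∞ (deriv g) :=
  (contDiff_infty_iff_deriv.1 hg).2

theorem smooth_radial {g : ℝ → ℝ} (hg : ContDiff ℝ ∞ g) : ContDiff ℝ ∞ (radial n g) :=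
  hg.comp (contDiff_norm_sq ℝ)

theorem smooth_radOp {g : ℝ → ℝ} (hg : ContDiff ℝ ∞ g) : ContDiff ℝ ∞ (radOp n g) :=
  ((contDiff_const.mul contDiff_id).mul (smooth_deriv (smooth_deriv hg))).add
    (contDiff_const.mul (smooth_deriv hg))

theorem smooth_radIter {g : ℝ → ℝ} (hg : ContDiff ℝ ∞ g) (k : ℕ) :
    ContDiff ℝ ∞ (radIter n k g) := by
  induction k with
  | zero => exact hg
  | succ k ih => rw [radIter_succ]; exact (smooth_radOp ih).neg

theorem hasFDerivAt_radial {g : ℝ → ℝ} (hg : Differentiable ℝ g) (z : EuclideanSpace ℝ (Fin n)) :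
    HasFDerivAt (radial n g) (deriv g (‖z‖ ^ 2) • (2 • innerSL ℝ z)) z :=
  (hg (‖z‖ ^ 2)).hasDerivAt.comp_hasFDerivAt z (hasStrictFDerivAt_norm_sq z).hasFDerivAt

theorem partialDeriv_radial {g : ℝ → ℝ} (hg : Differentiable ℝ g) (i : Fin n)
    (z : EuclideanSpace ℝ (Fin n)) :
    partialDeriv i (radial n g) z = 2 * z i * deriv g (‖z‖ ^ 2) := by
  unfold partialDeriv
  rw [(hasFDerivAt_radial hg z).fderiv]
  simp [EuclideanSpace.inner_single_right]
  ring

theorem partialDeriv_coord (i : Fin n) (z : EuclideanSpace ℝ (Fin n)) :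
    partialDeriv i (fun z : EuclideanSpace ℝ (Fin n) => z i) z = 1 := by
  have h : HasFDerivAt (fun z : EuclideanSpace ℝ (Fin n) => z i)
      (EuclideanSpace.proj (𝕜 := ℝ) i : EuclideanSpace ℝ (Fin n) →L[ℝ] ℝ) z :=
    (EuclideanSpace.proj (𝕜 := ℝ) i : EuclideanSpace ℝ (Fin n) →L[ℝ] ℝ).hasFDerivAt
  unfold partialDeriv
  rw [h.fderiv]
  simp

theorem differentiable_coord (i : Fin n) :
    Differentiable ℝ (fun z : EuclideanSpace ℝ (Fin n) => z i) :=
  (EuclideanSpace.proj (𝕜 := ℝ) i : EuclideanSpace ℝ (Fin n) →L[ℝ] ℝ).differentiable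

theorem laplacian_radial {g : ℝ → ℝ} (hg : ContDiff ℝ ∞ g) :
    Δ (radial n g) = radial n (radOp n g) := by
  rw [laplacian_eq_sum (smooth_radial hg)]
  ext z
  have hd := (smooth_deriv hg).differentiable (by simp)
  have h : ∀ i, partialDeriv i (partialDeriv i (radial n g)) z =
      4 * deriv (deriv g) (‖z‖ ^ 2) * (z i) ^ 2 + 2 * deriv g (‖z‖ ^ 2) := by
    intro i
    have h1 : partialDeriv i (radial n g) = fun z => (2 * z i) * radial n (deriv g) z :=
      funext fun z => partialDeriv_radial (hg.differentiable (by simp)) i z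
    rw [h1, partialDeriv_mul ((differentiable_coord i).const_mul 2)
      ((smooth_radial (smooth_deriv hg)).differentiable (by simp)),
      partialDeriv_radial hd, partialDeriv_mul (differentiable_const 2) (differentiable_coord i),
      partialDeriv_coord]
    have h0 : partialDeriv i (fun _ : EuclideanSpace ℝ (Fin n) => (2 : ℝ)) z = 0 := by
      simp [partialDeriv]
    rw [h0]
    simp only [radial]
    ring
  simp only [h, Finset.sum_add_distrib, ← Finset.mul_sum, Finset.sum_const, Finset.card_univ,
    Fintype.card_fin, nsmul_eq_mul, radial, radOp]
  rw [EuclideanSpace.real_norm_sq_eq]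
  ring

theorem iterLap_radial {g : ℝ → ℝ} (hg : ContDiff ℝ ∞ g) (k : ℕ) :
    iterLap k (radial n g) = radial n (radIter n k g) := by
  induction k with
  | zero => rfl
  | succ k ih =>
    rw [iterLap_succ', ih, laplacian_radial (smooth_radIter hg k), radIter_succ]
    rfl

theorem eqOn_deriv {g₁ g₂ : ℝ → ℝ} {U : Set ℝ} (hU : IsOpen U) (h : EqOn g₁ g₂ U) :
    EqOn (deriv g₁) (deriv g₂) U := fun _ hs =>
  (h.eventuallyEq_of_mem (hU.mem_nhds hs)).deriv_eq

/-- Locality on open sets lets the logarithm, singular at 0, be handled on (0, 1), (0, ∞) or (2, ∞)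
without extending it smoothly. -/
theorem eqOn_radIter {g₁ g₂ : ℝ → ℝ} {U : Set ℝ} (hU : IsOpen U) (h : EqOn g₁ g₂ U) (k : ℕ) :
    EqOn (radIter n k g₁) (radIter n k g₂) U := by
  induction k with
  | zero => exact h
  | succ k ih =>
    intro s hs
    simp only [radIter_succ, Pi.neg_apply, radOp]
    rw [eqOn_deriv hU ih hs, eqOn_deriv hU (eqOn_deriv hU ih) hs]

theorem contDiffOn_deriv {g : ℝ → ℝ} {U : Set ℝ} (hU : IsOpen U) (h : ContDiffOn ℝ ∞ g U) :
    ContDiffOn ℝ ∞ (deriv g) U := h.deriv_of_isOpen hU (by simp)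

theorem contDiffOn_radIter {g : ℝ → ℝ} {U : Set ℝ} (hU : IsOpen U) (h : ContDiffOn ℝ ∞ g U)
    (k : ℕ) : ContDiffOn ℝ ∞ (radIter n k g) U := by
  induction k with
  | zero => exact h
  | succ k ih =>
    rw [radIter_succ]
    refine ContDiffOn.neg ?_
    exact ((contDiff_const.mul contDiff_id).contDiffOn.mul
      (contDiffOn_deriv hU (contDiffOn_deriv hU ih))).add
        (contDiffOn_const.mul (contDiffOn_deriv hU ih))

theorem radIter_comp_mul (g : ℝ → ℝ) (c : ℝ) (k : ℕ) (s : ℝ) :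
    radIter n k (fun s => g (c * s)) s = c ^ k * radIter n k g (c * s) := by
  induction k generalizing s with
  | zero => simp [radIter]
  | succ k ih =>
    have h0 : radIter n k (fun s => g (c * s)) = fun s => c ^ k * radIter n k g (c * s) :=
      funext ih
    have h1 : ∀ h : ℝ → ℝ, deriv (fun s => c ^ k * h (c * s)) =
        fun s => c ^ k * (c * deriv h (c * s)) := by
      intro h
      ext s
      rw [deriv_const_mul_field, deriv_comp_mul_left, smul_eq_mul]
    have h2 : deriv (fun s => c ^ k * (c * deriv (radIter n k g) (c * s))) =
        fun s => c ^ k * (c * (c * deriv (deriv (radIter n k g)) (c * s))) := by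
      ext s
      rw [deriv_const_mul_field, deriv_const_mul_field, deriv_comp_mul_left, smul_eq_mul]
    simp only [radIter_succ, Pi.neg_apply, radOp]
    rw [h0, h1, h2]
    ring

theorem radIter_sub {g₁ g₂ : ℝ → ℝ} {U : Set ℝ} (hU : IsOpen U) (h₁ : ContDiffOn ℝ ∞ g₁ U)
    (h₂ : ContDiffOn ℝ ∞ g₂ U) (k : ℕ) :
    EqOn (radIter n k (fun s => g₁ s - g₂ s)) (fun s => radIter n k g₁ s - radIter n k g₂ s) U := by
  have hd : ∀ {f : ℝ → ℝ}, ContDiffOn ℝ ∞ f U → ∀ s ∈ U, DifferentiableAt ℝ f s :=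
    fun hf s hs => (hf.differentiableOn (by simp)).differentiableAt (hU.mem_nhds hs)
  have hs : ∀ {f₁ f₂ : ℝ → ℝ}, ContDiffOn ℝ ∞ f₁ U → ContDiffOn ℝ ∞ f₂ U →
      EqOn (deriv fun s => f₁ s - f₂ s) (fun s => deriv f₁ s - deriv f₂ s) U :=
    fun hf₁ hf₂ s hs => deriv_fun_sub (hd hf₁ s hs) (hd hf₂ s hs)
  induction k with
  | zero => exact fun s _ => rfl
  | succ k ih =>
    intro s hsU
    have c1 := contDiffOn_radIter (n := n) hU h₁ k
    have c2 := contDiffOn_radIter (n := n) hU h₂ k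
    have e1 := (eqOn_deriv hU ih).trans (hs c1 c2)
    have e2 := (eqOn_deriv hU e1).trans (hs (contDiffOn_deriv hU c1) (contDiffOn_deriv hU c2))
    simp only [radIter_succ, Pi.neg_apply, radOp]
    rw [e1 hsU, e2 hsU]
    ring

/-- In dimension 2(l+2) one has -D(s^{-j}) = 4j(l+1-j) s^{-j-1}; iterating from j = 1 builds the
factorial and the falling factorial. The latter vanishes at k = l + 1, which is the polyharmonicity
of the logarithm of order n/2 off the origin. -/
theorem radIter_log (l k : ℕ) (hk : k ≤ l + 1) :
    EqOn (radIter (2 * (l + 2)) (k + 1) (fun s => -(1 / 2) * Real.log s))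
      (fun s => 2 * (l + 1) * 4 ^ k * k.factorial * (l.descFactorial k : ℝ) * (s ^ (k + 1))⁻¹)
      (Ioi 0) := by
  induction k with
  | zero =>
    have e1 : deriv (fun s => -(1 / 2) * Real.log s) = fun s => -(1 / 2) * s⁻¹ := by
      ext s
      rw [deriv_const_mul_field, Real.deriv_log]
    have e2 : deriv (fun s : ℝ => -(1 / 2) * s⁻¹) = fun s => -(1 / 2) * (-(s ^ 2)⁻¹) := by
      ext s
      rw [deriv_const_mul_field, deriv_inv]
    intro s hs
    have hs' : s ≠ 0 := ne_of_gt hs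
    change -(radOp _ (fun s => -(1 / 2) * Real.log s) s) = _
    unfold radOp
    rw [e1, e2]
    simp
    field_simp
    ring
  | succ k ih =>
    have ih := ih (by omega)
    set c : ℝ := 2 * (l + 1) * 4 ^ k * k.factorial * (l.descFactorial k : ℝ) with hc
    have e1 : EqOn (deriv (fun s : ℝ => c * (s ^ (k + 1))⁻¹))
        (fun s => c * (-(k + 1) * (s ^ (k + 2))⁻¹)) (Ioi 0) := by
      intro s hs
      have hs' : s ≠ 0 := ne_of_gt hs
      have := ((hasDerivAt_pow (k + 1) s).inv (pow_ne_zero _ hs')).const_mul c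
      have h2 : HasDerivAt (fun s : ℝ => c * (s ^ (k + 1))⁻¹) _ s := this
      rw [h2.deriv]
      simp
      field_simp
      left
      ring
    have e2 : EqOn (deriv (fun s : ℝ => c * (-(k + 1) * (s ^ (k + 2))⁻¹)))
        (fun s => c * ((k + 1) * (k + 2) * (s ^ (k + 3))⁻¹)) (Ioi 0) := by
      intro s hs
      have hs' : s ≠ 0 := ne_of_gt hs
      have := (((hasDerivAt_pow (k + 2) s).inv (pow_ne_zero _ hs')).const_mul
        (-((k : ℝ) + 1))).const_mul c
      have h2 : HasDerivAt (fun s : ℝ => c * (-(k + 1) * (s ^ (k + 2))⁻¹)) _ s := this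
      rw [h2.deriv]
      simp
      field_simp
      left
      ring
    intro s hs
    have hs' : s ≠ 0 := ne_of_gt hs
    have d1 := (eqOn_deriv isOpen_Ioi ih).trans e1
    have d2 := (eqOn_deriv isOpen_Ioi d1).trans e2
    rw [radIter_succ, Pi.neg_apply, radOp, d1 hs, d2 hs]
    have hcast : ((l - k : ℕ) : ℝ) = l - k := by
      rw [Nat.cast_sub (by omega)]
    simp only [Nat.factorial_succ, Nat.descFactorial_succ, Nat.cast_mul, hcast, hc]
    push_cast
    field_simp
    ring

end Radial

/-! ### Truncated logarithms and the mass of their iterated Laplacian -/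

section Kernel

/-- A smooth cutoff on the line, `1` for `s ≤ 1` and `0` for `2 ≤ s`. -/
noncomputable def cutoff (s : ℝ) : ℝ := Real.smoothTransition (2 - s)

theorem smooth_cutoff : ContDiff ℝ ∞ cutoff :=
  Real.smoothTransition.contDiff.comp (contDiff_const.sub contDiff_id)

theorem cutoff_one {s : ℝ} (hs : s ≤ 1) : cutoff s = 1 :=
  Real.smoothTransition.one_of_one_le (by linarith)

theorem cutoff_zero {s : ℝ} (hs : 2 ≤ s) : cutoff s = 0 :=
  Real.smoothTransition.zero_of_nonpos (by linarith)

/-- The truncated logarithm. -/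
noncomputable def cutLog (s : ℝ) : ℝ := -(1 / 2) * Real.log s * cutoff s

theorem contDiffOn_cutLog : ContDiffOn ℝ ∞ cutLog (Ioi 0) := by
  unfold cutLog
  exact (contDiffOn_const.mul (Real.contDiffOn_log.mono fun s hs => ne_of_gt hs)).mul
    smooth_cutoff.contDiffOn

/-- A smooth compactly supported function equal to `cutLog (q s) - cutLog (p s)` for `s > 0`. -/
noncomputable def diffLog (p q s : ℝ) : ℝ :=
  1 / 2 * Real.log (p / q) * cutoff (p * s) -
    1 / 2 * Real.log (q * s) * (cutoff (q * s) - cutoff (p * s))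

variable {p q : ℝ}

theorem diffLog_eq (hq : 0 < q) (hp : 0 < p) {s : ℝ} (hs : 0 < s) :
    diffLog p q s = cutLog (q * s) - cutLog (p * s) := by
  unfold diffLog cutLog
  rw [Real.log_div hp.ne' hq.ne', Real.log_mul hq.ne' hs.ne', Real.log_mul hp.ne' hs.ne']
  ring

/-- The singularities of the two logarithms cancel: for s < 1/p both cutoffs equal 1, so the term
containing log s has coefficient zero and the function is constant near every s ≤ 0. -/
theorem smooth_diffLog (hq : 0 < q) (hqp : q ≤ p) : ContDiff ℝ ∞ (diffLog p q) := by
  have hp : 0 < p := hq.trans_le hqp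
  have hc : ∀ r : ℝ, ContDiff ℝ ∞ (fun s => cutoff (r * s)) := fun r =>
    smooth_cutoff.comp (contDiff_const.mul contDiff_id)
  rw [contDiff_iff_contDiffAt]
  intro s
  by_cases hs : 0 < s
  · refine ContDiffAt.sub (contDiff_const.mul (hc p)).contDiffAt
      (ContDiffAt.mul (contDiffAt_const.mul ?_) ((hc q).sub (hc p)).contDiffAt)
    exact (Real.contDiffAt_log.2 (mul_pos hq hs).ne').comp s
      (contDiff_const.mul contDiff_id).contDiffAt
  · have h : diffLog p q =ᶠ[𝓝 s] fun s => 1 / 2 * Real.log (p / q) * cutoff (p * s) := by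
      have hU : Iio (1 / p) ∈ 𝓝 s := isOpen_Iio.mem_nhds (by
        simp only [mem_Iio]; exact (not_lt.1 hs).trans_lt (by positivity))
      filter_upwards [hU] with t ht
      have ht : p * t ≤ 1 := by
        have := (lt_div_iff₀ hp).1 ht
        linarith
      have ht' : q * t ≤ 1 := by
        rcases le_or_gt t 0 with h | h
        · nlinarith
        · nlinarith
      simp [diffLog, cutoff_one ht, cutoff_one ht']
    exact ((contDiff_const.mul (hc p)).contDiffAt).congr_of_eventuallyEq h

theorem diffLog_zero (hq : 0 < q) (hqp : q ≤ p) {s : ℝ} (hs : 2 / q ≤ s) : diffLog p q s = 0 := by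
  have h1 : 2 ≤ q * s := by
    have := (div_le_iff₀ hq).1 hs
    linarith
  have h2 : 0 ≤ s := le_trans (by positivity) hs
  have h3 : 2 ≤ p * s := h1.trans (mul_le_mul_of_nonneg_right hqp h2)
  simp [diffLog, cutoff_zero h1, cutoff_zero h3]

theorem radial_diffLog_hasCompactSupport (n : ℕ) (hq : 0 < q) (hqp : q ≤ p) :
    HasCompactSupport (radial n (diffLog p q)) := by
  refine HasCompactSupport.intro (isCompact_closedBall 0 (2 / q + 1)) fun z hz => ?_
  refine diffLog_zero hq hqp ?_
  simp only [Metric.mem_closedBall, dist_zero_right, not_le] at hz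
  have : 0 < 2 / q := by positivity
  nlinarith

theorem exists_bound_of_constant_near_zero {h : ℝ → ℝ} {c : ℝ} (hc : ContinuousOn h (Ioi 0))
    (h1 : ∀ s, 0 < s → s < 1 → h s = c) (h2 : ∀ s, 2 < s → h s = 0) :
    ∃ C, 0 ≤ C ∧ ∀ s, 0 < s → |h s| ≤ C := by
  obtain ⟨C, hC⟩ := (isCompact_Icc (a := (1 / 2 : ℝ)) (b := 3)).exists_bound_of_continuousOn
    (hc.mono fun s hs => lt_of_lt_of_le (by norm_num) hs.1)
  refine ⟨max C |c|, le_max_of_le_right (abs_nonneg _), fun s hs => ?_⟩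
  by_cases ha : s < 1
  · rw [h1 s hs ha]; exact le_max_right _ _
  · by_cases hb : 2 < s
    · rw [h2 s hb]; simp
    · exact le_max_of_le_left (hC s ⟨by linarith, by linarith⟩)

/-- The logarithmic derivative of `cutLog (‖z‖²)`, up to the sign. -/
noncomputable def logKer (s : ℝ) : ℝ := -2 * s * deriv cutLog s

theorem eqOn_cutLog_log : EqOn cutLog (fun s => -(1 / 2) * Real.log s) (Ioo 0 1) := by
  intro s hs
  simp [cutLog, cutoff_one hs.2.le]

theorem eqOn_cutLog_zero : EqOn cutLog (fun _ => 0) (Ioi 2) := by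
  intro s hs
  simp [cutLog, cutoff_zero (le_of_lt hs)]

theorem continuousOn_logKer : ContinuousOn logKer (Ioi 0) :=
  (continuousOn_const.mul continuousOn_id).mul
    (contDiffOn_deriv isOpen_Ioi contDiffOn_cutLog).continuousOn

theorem logKer_one {s : ℝ} (h0 : 0 < s) (h1 : s < 1) : logKer s = 1 := by
  rw [logKer, eqOn_deriv isOpen_Ioo eqOn_cutLog_log ⟨h0, h1⟩, deriv_const_mul_field,
    Real.deriv_log]
  field_simp

theorem logKer_zero {s : ℝ} (h : 2 < s) : logKer s = 0 := by
  rw [logKer, eqOn_deriv isOpen_Ioi eqOn_cutLog_zero h]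
  simp

theorem exists_logKer_bound : ∃ C, 0 ≤ C ∧ ∀ s, 0 < s → |logKer s| ≤ C :=
  exists_bound_of_constant_near_zero (c := 1) continuousOn_logKer
    (fun _ h0 h1 => logKer_one h0 h1) fun _ h => logKer_zero h

theorem deriv_diffLog (hq : 0 < q) (hp : 0 < p) {s : ℝ} (hs : 0 < s) :
    2 * s * deriv (diffLog p q) s = -(logKer (q * s) - logKer (p * s)) := by
  have h : EqOn (diffLog p q) (fun s => cutLog (q * s) - cutLog (p * s)) (Ioi 0) :=
    fun t ht => diffLog_eq hq hp ht
  have hd : ∀ r : ℝ, 0 < r → DifferentiableAt ℝ (fun s => cutLog (r * s)) s := by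
    intro r hr
    refine DifferentiableAt.comp s (g := cutLog) ?_ (differentiableAt_id.const_mul r)
    exact (contDiffOn_cutLog.differentiableOn (by simp)).differentiableAt
      (isOpen_Ioi.mem_nhds (mul_pos hr hs))
  rw [eqOn_deriv isOpen_Ioi h hs, deriv_fun_sub (hd q hq) (hd p hp), deriv_comp_mul_left,
    deriv_comp_mul_left]
  simp only [logKer, smul_eq_mul]
  ring

/-- The profile of `(-Δ)^m` of the truncated logarithm. -/
noncomputable def profile (n m : ℕ) : ℝ → ℝ := radIter n m cutLog

variable {n m : ℕ}

theorem continuousOn_profile : ContinuousOn (profile n m) (Ioi 0) :=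
  (contDiffOn_radIter isOpen_Ioi contDiffOn_cutLog m).continuousOn

theorem radIter_zero_fun (k : ℕ) : radIter n k (fun _ => 0) = fun _ => 0 := by
  induction k with
  | zero => rfl
  | succ k ih =>
    rw [radIter_succ, ih]
    ext s
    simp [radOp]

theorem radIter_cutLog_zero (k : ℕ) : EqOn (radIter n k cutLog) (fun _ => 0) (Ioi 2) := by
  have := eqOn_radIter (n := n) isOpen_Ioi eqOn_cutLog_zero k
  rwa [radIter_zero_fun] at this

theorem radIter_cutLog_log (l k : ℕ) (hk : k ≤ l + 1) :
    EqOn (radIter (2 * (l + 2)) (k + 1) cutLog)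
      (fun s => 2 * (l + 1) * 4 ^ k * k.factorial * (l.descFactorial k : ℝ) * (s ^ (k + 1))⁻¹)
      (Ioo 0 1) :=
  (eqOn_radIter isOpen_Ioo eqOn_cutLog_log (k + 1)).trans
    ((radIter_log l k hk).mono fun _ h => h.1)

theorem profile_zero_near (l : ℕ) {s : ℝ} (h0 : 0 < s) (h1 : s < 1) :
    profile (2 * (l + 2)) (l + 2) s = 0 := by
  have := radIter_cutLog_log l (l + 1) le_rfl ⟨h0, h1⟩
  rw [profile, this]
  simp

theorem exists_profile_bound (l : ℕ) :
    ∃ C, 0 ≤ C ∧ ∀ s, 0 < s → |profile (2 * (l + 2)) (l + 2) s| ≤ C :=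
  exists_bound_of_constant_near_zero (c := 0) continuousOn_profile
    (fun _ h0 h1 => profile_zero_near l h0 h1) fun _ h => radIter_cutLog_zero _ h

theorem radIter_diffLog (hq : 0 < q) (hp : 0 < p) (k : ℕ) {s : ℝ} (hs : 0 < s) :
    radIter n k (diffLog p q) s =
      q ^ k * radIter n k cutLog (q * s) - p ^ k * radIter n k cutLog (p * s) := by
  have h : EqOn (diffLog p q) (fun s => cutLog (q * s) - cutLog (p * s)) (Ioi 0) :=
    fun t ht => diffLog_eq hq hp ht
  have hc : ∀ r : ℝ, 0 < r → ContDiffOn ℝ ∞ (fun s => cutLog (r * s)) (Ioi 0) := fun r hr =>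
    contDiffOn_cutLog.comp (contDiff_const.mul contDiff_id).contDiffOn
      fun s hs => mul_pos hr hs
  rw [eqOn_radIter isOpen_Ioi h k hs, radIter_sub isOpen_Ioi (hc q hq) (hc p hp) k hs]
  simp only [radIter_comp_mul]

/-- The radial Laplacian is a divergence, so the integrand is the derivative of -2 rⁿ h'(r²). The
profile lives in 1 ≤ r² ≤ 2; at r = 2 the boundary term vanishes, and at r = 1/2 it is read off the
explicit power in `radIter_log`. -/
theorem integral_profile_radius (l : ℕ) :
    ∫ r in Ioi (0 : ℝ), r ^ (2 * (l + 2) - 1) * profile (2 * (l + 2)) (l + 2) (r ^ 2) =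
      -(4 ^ (l + 1) * ((l + 1).factorial : ℝ) ^ 2) := by
  set h := radIter (2 * (l + 2)) (l + 1) cutLog with hh
  have hcd : ContDiffOn ℝ ∞ h (Ioi 0) := contDiffOn_radIter isOpen_Ioi contDiffOn_cutLog _
  have hcd' := contDiffOn_deriv isOpen_Ioi hcd
  have h1 : ∫ r in Ioi (0 : ℝ), r ^ (2 * (l + 2) - 1) * profile (2 * (l + 2)) (l + 2) (r ^ 2) =
      ∫ r in Ioc (1 / 2 : ℝ) 2, r ^ (2 * (l + 2) - 1) *
        profile (2 * (l + 2)) (l + 2) (r ^ 2) := by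
    refine setIntegral_eq_of_subset_of_forall_sdiff_eq_zero measurableSet_Ioi
      (fun r hr => lt_trans (by norm_num) hr.1) ?_
    rintro r ⟨hr0, hr⟩
    have hr0 : 0 < r := hr0
    simp only [mem_Ioc, not_and_or, not_lt, not_le] at hr
    rcases hr with hr | hr
    · rw [profile_zero_near l (by positivity) (by nlinarith), mul_zero]
    · rw [profile, radIter_cutLog_zero _ (show (2 : ℝ) < r ^ 2 by nlinarith), mul_zero]
  have hder : ∀ r ∈ uIcc (1 / 2 : ℝ) 2,
      HasDerivAt (fun r => -(2 * r ^ (2 * (l + 2)) * deriv h (r ^ 2)))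
        (r ^ (2 * (l + 2) - 1) * profile (2 * (l + 2)) (l + 2) (r ^ 2)) r := by
    intro r hr
    rw [uIcc_of_le (by norm_num)] at hr
    have hr0 : 0 < r := lt_of_lt_of_le (by norm_num) hr.1
    have hd : HasDerivAt (deriv h) (deriv (deriv h) (r ^ 2)) (r ^ 2) :=
      ((hcd'.differentiableOn (by simp)).differentiableAt
        (isOpen_Ioi.mem_nhds (show (0 : ℝ) < r ^ 2 by positivity))).hasDerivAt
    have hd2 : HasDerivAt (fun r : ℝ => deriv h (r ^ 2)) _ r :=
      HasDerivAt.comp (h₂ := deriv h) (h := fun r => r ^ 2) r hd (hasDerivAt_pow 2 r)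
    have hd3 := (((hasDerivAt_pow (2 * (l + 2)) r).const_mul 2).mul hd2).neg
    refine hd3.congr_deriv ?_
    rw [profile, radIter_succ, Pi.neg_apply, radOp, ← hh]
    have e1 : 2 * (l + 2) - 1 = 2 * l + 3 := by omega
    rw [e1]
    push_cast
    ring
  have hint : IntervalIntegrable
      (fun r => r ^ (2 * (l + 2) - 1) * profile (2 * (l + 2)) (l + 2) (r ^ 2)) volume (1 / 2) 2 := by
    refine ContinuousOn.intervalIntegrable ?_
    rw [uIcc_of_le (by norm_num)]
    refine (continuousOn_pow _).mul (continuousOn_profile.comp (continuousOn_pow 2) ?_)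
    intro r hr
    have hr0 : 0 < r := lt_of_lt_of_le (by norm_num) hr.1
    exact (show (0 : ℝ) < r ^ 2 by positivity)
  rw [h1, ← intervalIntegral.integral_of_le (by norm_num),
    intervalIntegral.integral_eq_sub_of_hasDerivAt hder hint]
  have e2 : deriv h (2 ^ 2) = 0 := by
    rw [eqOn_deriv isOpen_Ioi (radIter_cutLog_zero (l + 1)) (show (2 : ℝ) < 2 ^ 2 by norm_num)]
    simp
  have e3 : deriv h ((1 / 2) ^ 2) =
      -(2 * (l + 1) ^ 2 * 4 ^ l * (l.factorial : ℝ) ^ 2 * 4 ^ (l + 2)) := by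
    rw [eqOn_deriv isOpen_Ioo (radIter_cutLog_log l l (by omega))
      (show ((1 / 2 : ℝ)) ^ 2 ∈ Ioo (0 : ℝ) 1 by constructor <;> norm_num)]
    have := ((hasDerivAt_pow (l + 1) ((1 / 2 : ℝ) ^ 2)).inv
      (pow_ne_zero _ (by norm_num))).const_mul
      (2 * ((l : ℝ) + 1) * 4 ^ l * l.factorial * (l.descFactorial l : ℝ))
    have h2 : HasDerivAt (fun s : ℝ => 2 * ((l : ℝ) + 1) * 4 ^ l * l.factorial *
      (l.descFactorial l : ℝ) * (s ^ (l + 1))⁻¹) _ ((1 / 2) ^ 2) := this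
    rw [h2.deriv, Nat.descFactorial_self]
    have e4 : ((1 : ℝ) / 2) ^ 2 = (4 : ℝ)⁻¹ := by norm_num
    rw [e4]
    simp only [inv_pow]
    push_cast
    field_simp
    ring
  rw [e2, e3, Nat.factorial_succ]
  have e5 : ((1 : ℝ) / 2) ^ (2 * (l + 2)) = (4 ^ (l + 2))⁻¹ := by
    rw [pow_mul, ← inv_pow]; norm_num
  rw [e5]
  push_cast
  field_simp
  ring

/-- `(n - 1)! |𝕊ⁿ| / 2`, the total mass of `(-Δ)^{n/2}` of the logarithm. -/
noncomputable def kappa (n : ℕ) : ℝ := ((n - 1).factorial : ℝ) * sphereVolume n / 2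

/-- Matches the geometric normalisation with the constant delivered by the flux of the logarithm:
|𝕊ⁿ| is (n+1) times an odd-dimensional ball volume, whose double factorial is traded for ordinary
factorials. -/
theorem kappa_eq (l : ℕ) : kappa (2 * (l + 2)) =
    (2 * (l + 2)) * (volume : Measure (EuclideanSpace ℝ (Fin (2 * (l + 2))))).real
      (Metric.ball 0 1) * (4 ^ (l + 1) * ((l + 1).factorial : ℝ) ^ 2) := by
  have hodd := InnerProductSpace.volume_ball_of_dim_odd (k := l + 2)
    (E := EuclideanSpace ℝ (Fin (2 * (l + 2) + 1))) (by simp) 0 1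
  have heven := InnerProductSpace.volume_ball_of_dim_even (k := l + 2)
    (E := EuclideanSpace ℝ (Fin (2 * (l + 2)))) (by simp) 0 1
  rw [finrank_euclideanSpace_fin] at hodd heven
  simp only [ENNReal.ofReal_one, one_pow, one_mul] at hodd heven
  rw [kappa, sphereVolume, Measure.toSphere_real_apply_univ, finrank_euclideanSpace_fin,
    measureReal_def, measureReal_def, hodd, heven, ENNReal.toReal_ofReal (by positivity),
    ENNReal.toReal_ofReal (by positivity)]
  have hf : ((2 * (l + 2) + 1).factorial : ℝ) =
      (Nat.doubleFactorial (2 * (l + 2) + 1) : ℝ) * (2 ^ (l + 2) * (l + 2).factorial) := by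
    rw [Nat.factorial_eq_mul_doubleFactorial, Nat.doubleFactorial_two_mul]
    push_cast
    ring
  have hdf : (Nat.doubleFactorial (2 * (l + 2) + 1) : ℝ) ≠ 0 := by positivity
  have e1 : 2 * (l + 2) - 1 = 2 * l + 3 := by omega
  have e2 : 2 * (l + 2) + 1 = 2 * l + 3 + 1 + 1 := by omega
  have hf2 : ((2 * (l + 2) + 1).factorial : ℝ) =
      (2 * l + 5) * (2 * l + 4) * (2 * (l + 2) - 1).factorial := by
    rw [e1, e2, Nat.factorial_succ, Nat.factorial_succ]
    push_cast
    ring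
  rw [hf2] at hf
  have e4 : (4 : ℝ) ^ (l + 1) = 2 ^ l * 2 ^ l * 4 := by
    rw [← mul_pow, pow_succ]; norm_num
  have hl : ((l + 2).factorial : ℝ) = (l + 2) * (l + 1).factorial := by
    rw [Nat.factorial_succ]; push_cast; ring
  rw [hl] at hf ⊢
  have h0 : ((l + 1).factorial : ℝ) ≠ 0 := by positivity
  rw [e4]
  push_cast
  field_simp
  have h2 : ((l : ℝ) + 2) ≠ 0 := by positivity
  apply mul_left_cancel₀ h2
  linear_combination 2 ^ (l + 2) * hf

/-- The minus sign reflects that a compactly supported distribution (-Δ)^m v with m ≥ 1 has total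
mass zero: the point mass κ at the origin is balanced by the smooth part in the cutoff region. -/
theorem integral_profile (l : ℕ) :
    ∫ z : EuclideanSpace ℝ (Fin (2 * (l + 2))), profile (2 * (l + 2)) (l + 2) (‖z‖ ^ 2) =
      -kappa (2 * (l + 2)) := by
  have := integral_fun_norm_addHaar (volume : Measure (EuclideanSpace ℝ (Fin (2 * (l + 2)))))
    (fun r => profile (2 * (l + 2)) (l + 2) (r ^ 2))
  rw [this, finrank_euclideanSpace_fin]
  simp only [smul_eq_mul, nsmul_eq_mul]
  rw [integral_profile_radius, kappa_eq]
  push_cast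
  ring

end Kernel

/-! ### Scale-invariant energy estimate -/

section Caccioppoli

variable {n : ℕ} {u : EuclideanSpace ℝ (Fin n) → ℝ}

/-- The squared norm of the gradient. -/
noncomputable def gradSq (u : EuclideanSpace ℝ (Fin n) → ℝ) (x : EuclideanSpace ℝ (Fin n)) : ℝ :=
  ∑ i, (partialDeriv i u x) ^ 2

/-- `Δu + (n-2)/2 |∇u|²`, a negative multiple of `e^{2u}` times the scalar curvature. -/
noncomputable def confLap (u : EuclideanSpace ℝ (Fin n) → ℝ) (x : EuclideanSpace ℝ (Fin n)) : ℝ :=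
  Δ u x + (n - 2) / 2 * gradSq u x

theorem gradSq_nonneg (x : EuclideanSpace ℝ (Fin n)) : 0 ≤ gradSq u x :=
  Finset.sum_nonneg fun _ _ => sq_nonneg _

theorem continuous_partialDeriv (hu : ContDiff ℝ ∞ u) (i : Fin n) :
    Continuous (partialDeriv i u) := (smooth_partialDeriv hu i).continuous

theorem continuous_gradSq (hu : ContDiff ℝ ∞ u) : Continuous (gradSq u) :=
  continuous_finsetSum _ fun i _ => (continuous_partialDeriv hu i).pow 2

theorem continuous_confLap (hu : ContDiff ℝ ∞ u) : Continuous (confLap u) :=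
  (smooth_laplacian hu).continuous.add (continuous_const.mul (continuous_gradSq hu))

theorem confLap_rescale (hu : ContDiff ℝ ∞ u) (x : EuclideanSpace ℝ (Fin n)) (R : ℝ)
    (z : EuclideanSpace ℝ (Fin n)) :
    confLap (rescale u x R) z = R ^ 2 * confLap u (x + R • z) := by
  unfold confLap gradSq
  simp only [laplacian_rescale hu, partialDeriv_rescale hu, mul_pow, ← Finset.mul_sum]
  ring

/-- Test Δw + a|∇w|² ≤ F with φ², where a = (n-2)/2 > 0 and F is the positive part. The cross term
2φ ∇φ·∇w is absorbed into half of aφ²|∇w|². The one-sided bound suffices because the gradient term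
has a favourable sign. -/
theorem exists_caccioppoli (hn : 3 ≤ n) (m : ℕ) (hm : m ≠ 0) :
    ∃ C, 0 ≤ C ∧ ∀ w : EuclideanSpace ℝ (Fin n) → ℝ, ContDiff ℝ ∞ w →
      Integrable (fun z => (max (confLap w z) 0) ^ m) →
      ∫ z in Metric.ball 0 2, gradSq w z ≤ C * (1 + ∫ z, (max (confLap w z) 0) ^ m) := by
  obtain ⟨φ, hφs, hφc, hφ1, hφr⟩ : ∃ φ : EuclideanSpace ℝ (Fin n) → ℝ, ContDiff ℝ ∞ φ ∧
      HasCompactSupport φ ∧ (∀ z ∈ Metric.ball (0 : EuclideanSpace ℝ (Fin n)) 2, φ z = 1) ∧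
      ∀ z, φ z ∈ Icc (0 : ℝ) 1 := by
    let b : ContDiffBump (0 : EuclideanSpace ℝ (Fin n)) := ⟨2, 3, by norm_num, by norm_num⟩
    exact ⟨b, b.contDiff, b.hasCompactSupport,
      fun z hz => b.one_of_mem_closedBall (Metric.ball_subset_closedBall hz),
      fun z => ⟨b.nonneg, b.le_one⟩⟩
  set a : ℝ := ((n : ℝ) - 2) / 2 with ha
  have ha0 : 0 < a := by
    have : (3 : ℝ) ≤ n := by exact_mod_cast hn
    rw [ha]; linarith
  set C₁ : ℝ := (∫ z, φ z ^ 2) + 2 / a * ∫ z, gradSq φ z with hC₁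
  have hC₁0 : 0 ≤ C₁ := add_nonneg (integral_nonneg fun z => sq_nonneg _)
    (mul_nonneg (by positivity) (integral_nonneg fun z => gradSq_nonneg z))
  refine ⟨2 / a * (C₁ + 1), by positivity, fun w hw hF => ?_⟩
  have hφ2s : ContDiff ℝ ∞ (fun z => φ z * φ z) := hφs.mul hφs
  have hφ2c : HasCompactSupport (fun z => φ z * φ z) := hφc.mul_right
  have hgc : HasCompactSupport (gradSq φ) := by
    refine hφc.mono' fun z hz => ?_
    by_contra h
    apply hz
    have : fderiv ℝ φ z = 0 := by
      by_contra h'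
      exact h (support_fderiv_subset ℝ h')
    simp [gradSq, partialDeriv, this]
  have i1 : Integrable (fun z => φ z ^ 2) := by
    simpa [sq] using hφ2s.continuous.integrable_of_hasCompactSupport hφ2c
  have i2 : Integrable (gradSq φ) := (continuous_gradSq hφs).integrable_of_hasCompactSupport hgc
  have i3 : Integrable (fun z => φ z * φ z * Δ w z) :=
    (hφ2s.continuous.mul (smooth_laplacian hw).continuous).integrable_of_hasCompactSupport
      hφ2c.mul_right
  have i4 : ∀ i, Integrable (fun z => partialDeriv i (fun z => φ z * φ z) z * partialDeriv i w z) :=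
    fun i => ((continuous_partialDeriv hφ2s i).mul
      (continuous_partialDeriv hw i)).integrable_of_hasCompactSupport
      (partialDeriv_hasCompactSupport hφ2c i).mul_right
  have i4' := integrable_finsetSum Finset.univ fun i _ => i4 i
  have i5 : Integrable (fun z => φ z ^ 2 * gradSq w z) := by
    have h := (hφ2s.continuous.mul (continuous_gradSq hw)).integrable_of_hasCompactSupport
      (μ := volume) hφ2c.mul_right
    refine h.congr (Eventually.of_forall fun z => ?_)
    simp [sq]
  have hibp : (∫ z, φ z * φ z * Δ w z) +
      ∫ z, ∑ i, partialDeriv i (fun z => φ z * φ z) z * partialDeriv i w z = 0 := by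
    rw [integral_mul_laplacian hφ2s hφ2c hw, integral_finsetSum _ fun i _ => i4 i]
    ring
  have hpt : ∀ z, a / 2 * (φ z ^ 2 * gradSq w z) ≤
      (φ z ^ 2 + (max (confLap w z) 0) ^ m + 2 / a * gradSq φ z) -
      (φ z * φ z * Δ w z + ∑ i, partialDeriv i (fun z => φ z * φ z) z * partialDeriv i w z) := by
    intro z
    set F := max (confLap w z) 0 with hFd
    have hF0 : 0 ≤ F := le_max_right _ _
    have hF1 : Δ w z + a * gradSq w z ≤ F := le_max_left _ _
    -- Replaces F by the power whose integral is assumed finite, avoiding Hölder's inequality.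
    have hFm : F ≤ 1 + F ^ m := by
      rcases le_or_gt F 1 with h | h
      · have := pow_nonneg hF0 m; linarith
      · have := le_self_pow₀ h.le hm; linarith
    have hφz := hφr z
    have hφsq : φ z ^ 2 ≤ 1 := by nlinarith [hφz.1, hφz.2]
    have h1 : φ z ^ 2 * F ≤ φ z ^ 2 + F ^ m := by
      have h2 := mul_le_mul_of_nonneg_left hFm (sq_nonneg (φ z))
      have h3 := mul_le_mul_of_nonneg_right hφsq (pow_nonneg hF0 m)
      nlinarith
    have h4 := mul_le_mul_of_nonneg_left hF1 (sq_nonneg (φ z))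
    -- The absorption: coordinate by coordinate the difference is a perfect square.
    have h5 : 0 ≤ a / 2 * (φ z ^ 2 * gradSq w z) + 2 / a * gradSq φ z -
        ∑ i, partialDeriv i (fun z => φ z * φ z) z * partialDeriv i w z := by
      unfold gradSq
      rw [Finset.mul_sum, Finset.mul_sum, Finset.mul_sum, ← Finset.sum_add_distrib,
        ← Finset.sum_sub_distrib]
      refine Finset.sum_nonneg fun i _ => ?_
      rw [partialDeriv_mul (hφs.differentiable (by simp)) (hφs.differentiable (by simp))]
      have : a / 2 * (φ z ^ 2 * partialDeriv i w z ^ 2) + 2 / a * partialDeriv i φ z ^ 2 -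
          (φ z * partialDeriv i φ z + partialDeriv i φ z * φ z) * partialDeriv i w z =
          1 / (2 * a) * (a * φ z * partialDeriv i w z - 2 * partialDeriv i φ z) ^ 2 := by
        field_simp
        ring
      rw [this]
      positivity
    nlinarith
  have hint := integral_mono (i5.const_mul (a / 2)) (((i1.add hF).add (i2.const_mul (2 / a))).sub
    (i3.add i4')) hpt
  have hL : ∫ z in Metric.ball 0 2, gradSq w z ≤ ∫ z, φ z ^ 2 * gradSq w z := by
    calc ∫ z in Metric.ball 0 2, gradSq w z = ∫ z in Metric.ball 0 2, φ z ^ 2 * gradSq w z :=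
          setIntegral_congr_fun measurableSet_ball fun z hz => by simp [hφ1 z hz]
      _ ≤ _ := setIntegral_le_integral i5
          (Eventually.of_forall fun z => mul_nonneg (sq_nonneg _) (gradSq_nonneg z))
  rw [integral_const_mul] at hint
  have hR : ∫ z, ((φ z ^ 2 + (max (confLap w z) 0) ^ m + 2 / a * gradSq φ z) -
      (φ z * φ z * Δ w z + ∑ i, partialDeriv i (fun z => φ z * φ z) z * partialDeriv i w z)) =
      C₁ + ∫ z, (max (confLap w z) 0) ^ m := by
    refine (integral_sub ((i1.add hF).add (i2.const_mul (2 / a))) (i3.add i4')).trans ?_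
    have e1 := integral_add (i1.add hF) (i2.const_mul (2 / a))
    have e2 := integral_add i1 hF
    have e3 := integral_add i3 i4'
    simp only [Pi.add_apply] at e1 e2 e3 ⊢
    rw [e1, e2, e3, hibp, integral_const_mul]
    ring
  have hint' : a / 2 * ∫ z, φ z ^ 2 * gradSq w z ≤ C₁ + ∫ z, (max (confLap w z) 0) ^ m :=
    hint.trans_eq hR
  have hFi : 0 ≤ ∫ z, (max (confLap w z) 0) ^ m :=
    integral_nonneg fun z => pow_nonneg (le_max_right _ _) m
  have h7 : a / 2 * ∫ z in Metric.ball 0 2, gradSq w z ≤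
      (C₁ + 1) * (1 + ∫ z, (max (confLap w z) 0) ^ m) := by
    have := mul_le_mul_of_nonneg_left hL (by positivity : 0 ≤ a / 2)
    nlinarith [mul_nonneg hC₁0 hFi]
  calc ∫ z in Metric.ball 0 2, gradSq w z
      = 2 / a * (a / 2 * ∫ z in Metric.ball 0 2, gradSq w z) := by field_simp
    _ ≤ 2 / a * ((C₁ + 1) * (1 + ∫ z, (max (confLap w z) 0) ^ m)) :=
      mul_le_mul_of_nonneg_left h7 (by positivity)
    _ = _ := by ring

theorem integral_comp_affine {n : ℕ} (g : EuclideanSpace ℝ (Fin n) → ℝ)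
    (x : EuclideanSpace ℝ (Fin n)) {R : ℝ} (hR : 0 < R) :
    ∫ z, R ^ n * g (x + R • z) = ∫ z, g z := by
  rw [integral_const_mul, Measure.integral_comp_smul volume (fun z => g (x + z)) R,
    integral_add_left_eq_self g x, finrank_euclideanSpace_fin, smul_eq_mul, ← mul_assoc,
    abs_of_pos (by positivity), mul_inv_cancel₀ (by positivity), one_mul]

theorem integrable_comp_affine {n : ℕ} {g : EuclideanSpace ℝ (Fin n) → ℝ} (hg : Integrable g)
    (x : EuclideanSpace ℝ (Fin n)) {R : ℝ} (hR : 0 < R) :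
    Integrable (fun z => R ^ n * g (x + R • z)) :=
  ((hg.comp_add_left x).comp_smul hR.ne').const_mul _

/-- Conformal invariance: K scales by R², and n = 2m makes its m-th power scale exactly by the
Jacobian Rⁿ. -/
theorem max_confLap_rescale_pow (hu : ContDiff ℝ ∞ u) {m : ℕ} (hm : n = 2 * m)
    (x : EuclideanSpace ℝ (Fin n)) {R : ℝ} (hR : 0 < R) (z : EuclideanSpace ℝ (Fin n)) :
    (max (confLap (rescale u x R) z) 0) ^ m =
      R ^ n * (max (confLap u (x + R • z)) 0) ^ m := by
  have hRn : R ^ n = (R ^ 2) ^ m := by rw [← pow_mul, hm]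
  rw [confLap_rescale hu, hRn, ← mul_pow]
  congr 1
  rw [mul_max_of_nonneg _ _ (by positivity), mul_zero]

/-- The constant is independent of centre and scale, since the right side of the Caccioppoli
inequality is invariant under rescaling. -/
theorem exists_gradSq_bound (hu : ContDiff ℝ ∞ u) (hn : 3 ≤ n) {m : ℕ} (hm : n = 2 * m)
    (hF : Integrable (fun z => (max (confLap u z) 0) ^ m)) :
    ∃ C, 0 ≤ C ∧ ∀ x, ∀ R > 0, ∫ z in Metric.ball 0 2, gradSq (rescale u x R) z ≤ C := by
  obtain ⟨C, hC0, hC⟩ := exists_caccioppoli hn m (by omega)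
  have hFi : 0 ≤ ∫ z, (max (confLap u z) 0) ^ m :=
    integral_nonneg fun z => pow_nonneg (le_max_right _ _) m
  refine ⟨C * (1 + ∫ z, (max (confLap u z) 0) ^ m), by positivity, fun x R hR => ?_⟩
  have := hC (rescale u x R) (rescale_smooth hu x R)
  simp only [max_confLap_rescale_pow hu hm x hR] at this
  rw [integral_comp_affine (fun z => (max (confLap u z) 0) ^ m) x hR] at this
  exact this (integrable_comp_affine hF x hR)

end Caccioppoli

/-! ### Gradient of u as a singular integral of its iterated Laplacian -/

section Representation

variable {n : ℕ}

/-- In polar coordinates the density is r^{n-3}, whence the restriction on n. -/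
theorem integrableOn_norm_sq_inv (hn : 3 ≤ n) (r : ℝ) :
    IntegrableOn (fun z : EuclideanSpace ℝ (Fin n) => (‖z‖ ^ 2)⁻¹) (Metric.ball 0 r) := by
  have : Nontrivial (EuclideanSpace ℝ (Fin n)) :=
    Module.nontrivial_of_finrank_pos (R := ℝ) (by rw [finrank_euclideanSpace_fin]; omega)
  have h := (integrableOn_fun_norm_addHaar (volume : Measure (EuclideanSpace ℝ (Fin n)))
    (f := fun y : ℝ => (y ^ 2)⁻¹) (r := r)).2 ?_
  · exact h
  rw [finrank_euclideanSpace_fin]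
  have h2 : IntegrableOn (fun y : ℝ => y ^ (n - 3)) (Ioo 0 r) :=
    ((continuous_pow (n - 3)).integrableOn_Icc (a := 0) (b := r)).mono_set Ioo_subset_Icc_self
  refine h2.congr_fun (fun y hy => ?_) measurableSet_Ioo
  have hy0 : y ≠ 0 := ne_of_gt hy.1
  have h3 : n - 1 = n - 3 + 2 := by omega
  simp only [smul_eq_mul]
  rw [h3, pow_add]
  field_simp

theorem integrable_mul_norm_inv (hn : 3 ≤ n) {f : EuclideanSpace ℝ (Fin n) → ℝ}
    (hf : Continuous f) (hfi : Integrable f) : Integrable (fun z => |f z| * ‖z‖⁻¹) := by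
  obtain ⟨C, hC⟩ := (isCompact_closedBall (0 : EuclideanSpace ℝ (Fin n)) 1).exists_bound_of_continuousOn
    hf.continuousOn
  have hm : AEStronglyMeasurable (fun z => |f z| * ‖z‖⁻¹) volume :=
    (hf.abs.measurable.mul measurable_norm.inv).aestronglyMeasurable
  have h1 : IntegrableOn (fun z => |f z| * ‖z‖⁻¹) (Metric.ball 0 1) := by
    refine Integrable.mono' ((integrableOn_norm_sq_inv hn 1).const_mul C) hm.restrict ?_
    refine (ae_restrict_iff' measurableSet_ball).2 (Eventually.of_forall fun z hz => ?_)
    rw [Real.norm_eq_abs, abs_of_nonneg (by positivity)]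
    have hz' := Metric.ball_subset_closedBall hz
    have hz1 : ‖z‖ < 1 := by simpa using hz
    have h2 : ‖z‖⁻¹ ≤ (‖z‖ ^ 2)⁻¹ := by
      rcases eq_or_ne z 0 with rfl | h0
      · simp
      · have : 0 < ‖z‖ := norm_pos_iff.2 h0
        exact inv_anti₀ (by positivity) (by nlinarith)
    exact mul_le_mul (hC z hz') h2 (by positivity) ((norm_nonneg _).trans (hC z hz'))
  have h2 : IntegrableOn (fun z => |f z| * ‖z‖⁻¹) (Metric.ball 0 1)ᶜ := by
    refine Integrable.mono' hfi.abs.integrableOn hm.restrict ?_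
    refine (ae_restrict_iff' measurableSet_ball.compl).2 (Eventually.of_forall fun z hz => ?_)
    rw [Real.norm_eq_abs, abs_of_nonneg (by positivity)]
    have hz1 : 1 ≤ ‖z‖ := by simpa using hz
    exact mul_le_of_le_one_right (abs_nonneg _) (inv_le_one_of_one_le₀ hz1)
  have := h1.union h2
  rwa [union_compl_self, integrableOn_univ] at this

theorem abs_coord_le_norm (z : EuclideanSpace ℝ (Fin n)) (i : Fin n) : |z i| ≤ ‖z‖ := by
  simpa using PiLp.norm_apply_le z i

/-- The `i`-th component of `z / |z|²`. -/
noncomputable def field (i : Fin n) (z : EuclideanSpace ℝ (Fin n)) : ℝ := z i / ‖z‖ ^ 2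

theorem abs_field_le (i : Fin n) (z : EuclideanSpace ℝ (Fin n)) : |field i z| ≤ ‖z‖⁻¹ := by
  rcases eq_or_ne z 0 with rfl | h0
  · simp [field]
  · have : 0 < ‖z‖ := norm_pos_iff.2 h0
    rw [field, abs_div, abs_of_nonneg (by positivity : 0 ≤ ‖z‖ ^ 2), div_le_iff₀ (by positivity)]
    calc |z i| ≤ ‖z‖ := abs_coord_le_norm z i
      _ = _ := by field_simp

theorem measurable_coord (i : Fin n) : Measurable (fun z : EuclideanSpace ℝ (Fin n) => z i) :=
  (differentiable_coord i).continuous.measurable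

theorem measurable_field (i : Fin n) : Measurable (field i) :=
  (measurable_coord i).div (measurable_norm.pow_const 2)

theorem aestronglyMeasurable_comp_norm_sq {g : ℝ → ℝ} (hg : ContinuousOn g (Ioi 0)) (hn : 1 ≤ n)
    {c : ℝ} (hc : 0 < c) :
    AEStronglyMeasurable (fun z : EuclideanSpace ℝ (Fin n) => g (c * ‖z‖ ^ 2)) volume := by
  have : Nontrivial (EuclideanSpace ℝ (Fin n)) :=
    Module.nontrivial_of_finrank_pos (R := ℝ) (by rw [finrank_euclideanSpace_fin]; omega)
  rw [← restrict_compl_singleton (μ := volume) (0 : EuclideanSpace ℝ (Fin n))]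
  refine ContinuousOn.aestronglyMeasurable (hg.comp
    (continuous_const.mul (continuous_norm.pow 2)).continuousOn fun z hz => ?_)
    (measurableSet_singleton _).compl
  have : 0 < ‖z‖ := norm_pos_iff.2 hz
  exact mul_pos hc (by positivity)

theorem ae_ne_zero (hn : 1 ≤ n) : ∀ᵐ z : EuclideanSpace ℝ (Fin n), z ≠ 0 := by
  have : Nontrivial (EuclideanSpace ℝ (Fin n)) :=
    Module.nontrivial_of_finrank_pos (R := ℝ) (by rw [finrank_euclideanSpace_fin]; omega)
  exact compl_mem_ae_iff.2 (measure_singleton (0 : EuclideanSpace ℝ (Fin n)))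

theorem partialDeriv_radial_diffLog {p q : ℝ} (hq : 0 < q) (hqp : q ≤ p) (i : Fin n)
    (z : EuclideanSpace ℝ (Fin n)) :
    partialDeriv i (radial n (diffLog p q)) z =
      -(field i z * (logKer (q * ‖z‖ ^ 2) - logKer (p * ‖z‖ ^ 2))) := by
  rw [partialDeriv_radial ((smooth_diffLog hq hqp).differentiable (by simp))]
  rcases eq_or_ne z 0 with rfl | h0
  · simp [field]
  · have hz : 0 < ‖z‖ := norm_pos_iff.2 h0
    have := deriv_diffLog hq (hq.trans_le hqp) (s := ‖z‖ ^ 2) (by positivity)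
    have h2 : 2 * z i * deriv (diffLog p q) (‖z‖ ^ 2) =
        field i z * (2 * ‖z‖ ^ 2 * deriv (diffLog p q) (‖z‖ ^ 2)) := by
      unfold field
      field_simp
    rw [h2, this]
    ring

/-- With p = (k+1)² and q = 1/p, for each fixed z ≠ 0 the two `logKer` factors are eventually 1 and
0, so the integrand is eventually constant in k. A multiple of |f|/‖z‖ dominates it. -/
theorem tendsto_integral_partialDeriv_diffLog (hn : 3 ≤ n) {f : EuclideanSpace ℝ (Fin n) → ℝ}
    (hf : Continuous f) (hfi : Integrable f) (i : Fin n) :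
    Tendsto (fun k : ℕ => ∫ z, partialDeriv i
      (radial n (diffLog (((k : ℝ) + 1) ^ 2) ((((k : ℝ) + 1) ^ 2)⁻¹))) z * f z) atTop
      (𝓝 (-∫ z, field i z * f z)) := by
  obtain ⟨C, hC0, hC⟩ := exists_logKer_bound
  rw [← integral_neg]
  have hp : ∀ k : ℕ, (1 : ℝ) ≤ ((k : ℝ) + 1) ^ 2 := fun k => by
    have : (0 : ℝ) ≤ k := k.cast_nonneg
    nlinarith
  have hqp : ∀ k : ℕ, (((k : ℝ) + 1) ^ 2)⁻¹ ≤ ((k : ℝ) + 1) ^ 2 := fun k =>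
    (inv_le_one_of_one_le₀ (hp k)).trans (hp k)
  have hq : ∀ k : ℕ, 0 < (((k : ℝ) + 1) ^ 2)⁻¹ := fun k => by positivity
  have hlim : Tendsto (fun k : ℕ => ((k : ℝ) + 1) ^ 2) atTop atTop :=
    (tendsto_pow_atTop (by norm_num)).comp
      (tendsto_atTop_add_const_right _ _ tendsto_natCast_atTop_atTop)
  refine tendsto_integral_of_dominated_convergence (fun z => 2 * C * (|f z| * ‖z‖⁻¹)) ?_
    ((integrable_mul_norm_inv hn hf hfi).const_mul _) ?_ ?_
  · intro k
    exact ((continuous_partialDeriv (smooth_radial (smooth_diffLog (hq k) (hqp k))) i).mul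
      hf).aestronglyMeasurable
  · intro k
    filter_upwards [ae_ne_zero (n := n) (by omega)] with z hz
    have hz : 0 < ‖z‖ := norm_pos_iff.2 hz
    rw [partialDeriv_radial_diffLog (hq k) (hqp k), norm_mul, norm_neg, norm_mul, Real.norm_eq_abs,
      Real.norm_eq_abs, Real.norm_eq_abs]
    have h1 := hC _ (mul_pos (hq k) (pow_pos hz 2))
    have h2 := hC _ (mul_pos ((hq k).trans_le (hqp k)) (pow_pos hz 2))
    have h3 : |logKer ((((k : ℝ) + 1) ^ 2)⁻¹ * ‖z‖ ^ 2) - logKer (((k : ℝ) + 1) ^ 2 * ‖z‖ ^ 2)|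
        ≤ 2 * C := (abs_sub _ _).trans (by linarith)
    calc _ ≤ ‖z‖⁻¹ * (2 * C) * |f z| := by
          gcongr
          exact abs_field_le i z
      _ = _ := by ring
  · filter_upwards [ae_ne_zero (n := n) (by omega)] with z hz
    have hz : 0 < ‖z‖ := norm_pos_iff.2 hz
    refine tendsto_const_nhds.congr' ?_
    filter_upwards [hlim.eventually_gt_atTop (‖z‖ ^ 2),
      hlim.eventually_gt_atTop (2 / ‖z‖ ^ 2)] with k h1 h2
    rw [partialDeriv_radial_diffLog (hq k) (hqp k), logKer_one (by positivity), logKer_zero]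
    · ring
    · exact (div_lt_iff₀ (by positivity)).1 h2
    · rw [inv_mul_lt_iff₀ (by positivity)]; linarith

/-! ### Limits at small and large scales -/

section Profile

variable {l : ℕ}

theorem profile_far {z : EuclideanSpace ℝ (Fin n)} (m : ℕ) (hz : 2 ≤ ‖z‖) :
    profile n m (‖z‖ ^ 2) = 0 :=
  radIter_cutLog_zero m (show (2 : ℝ) < ‖z‖ ^ 2 by nlinarith)

theorem integrable_profile_mul {g : EuclideanSpace ℝ (Fin (2 * (l + 2))) → ℝ} (hg : Continuous g) :
    Integrable (fun z => profile (2 * (l + 2)) (l + 2) (‖z‖ ^ 2) * g z) := by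
  obtain ⟨C, hC0, hC⟩ := exists_profile_bound l
  have hb : Integrable (indicator (Metric.closedBall 0 2) fun z => C * |g z|) :=
    (((continuous_const.mul hg.abs).continuousOn).integrableOn_compact
      (isCompact_closedBall 0 2)).integrable_indicator Metric.isClosed_closedBall.measurableSet
  refine hb.mono' ?_ ?_
  · have := aestronglyMeasurable_comp_norm_sq (n := 2 * (l + 2)) (c := 1)
      (continuousOn_profile (n := 2 * (l + 2)) (m := l + 2)) (by omega) one_pos
    simp only [one_mul] at this
    exact this.mul hg.aestronglyMeasurable
  · filter_upwards [ae_ne_zero (n := 2 * (l + 2)) (by omega)] with z hz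
    have hz : 0 < ‖z‖ := norm_pos_iff.2 hz
    by_cases h : z ∈ Metric.closedBall (0 : EuclideanSpace ℝ (Fin (2 * (l + 2)))) 2
    · rw [indicator_of_mem h, norm_mul]
      exact mul_le_mul_of_nonneg_right (hC _ (by positivity)) (abs_nonneg _)
    · rw [indicator_of_notMem h, profile_far]
      · simp
      · simp only [Metric.mem_closedBall, dist_zero_right, not_le] at h
        exact h.le

/-- The two truncated logarithms separate here. Since n = 2(l+2), the factor (R⁻²)^{l+2} is the
Jacobian of z ↦ R⁻¹z, so each becomes the fixed profile tested on a dilate of g. -/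
theorem integral_iterLap_diffLog_mul {g : EuclideanSpace ℝ (Fin (2 * (l + 2))) → ℝ}
    (hg : Continuous g) {t : ℝ} (ht : 1 ≤ t) :
    ∫ z, iterLap (l + 2) (radial (2 * (l + 2)) (diffLog (t ^ 2) (t ^ 2)⁻¹)) z * g z =
      (∫ z, profile (2 * (l + 2)) (l + 2) (‖z‖ ^ 2) * g (t • z)) -
        ∫ z, profile (2 * (l + 2)) (l + 2) (‖z‖ ^ 2) * g (t⁻¹ • z) := by
  have ht0 : 0 < t := by linarith
  have hp1 : 1 ≤ t ^ 2 := by nlinarith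
  have hqp : (t ^ 2)⁻¹ ≤ t ^ 2 := (inv_le_one_of_one_le₀ hp1).trans hp1
  have key : ∀ R : ℝ, 0 < R →
      Integrable (fun z => ((R ^ 2)⁻¹) ^ (l + 2) *
        profile (2 * (l + 2)) (l + 2) ((R ^ 2)⁻¹ * ‖z‖ ^ 2) * g z) ∧
      ∫ z, ((R ^ 2)⁻¹) ^ (l + 2) *
        profile (2 * (l + 2)) (l + 2) ((R ^ 2)⁻¹ * ‖z‖ ^ 2) * g z =
      ∫ z, profile (2 * (l + 2)) (l + 2) (‖z‖ ^ 2) * g (R • z) := by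
    intro R hR
    have hgR : Continuous fun z => g (R • z) := hg.comp (continuous_const_smul R)
    have hR' : 0 < R⁻¹ := by positivity
    have h1 := integrable_comp_affine (integrable_profile_mul hgR) 0 hR'
    have h2 := integral_comp_affine
      (fun z => profile (2 * (l + 2)) (l + 2) (‖z‖ ^ 2) * g (R • z)) 0 hR'
    have h3 : (fun z => ((R ^ 2)⁻¹) ^ (l + 2) *
        profile (2 * (l + 2)) (l + 2) ((R ^ 2)⁻¹ * ‖z‖ ^ 2) * g z) =
        fun z => R⁻¹ ^ (2 * (l + 2)) * (profile (2 * (l + 2)) (l + 2) (‖0 + R⁻¹ • z‖ ^ 2) *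
          g (R • (0 + R⁻¹ • z))) := by
      ext z
      rw [zero_add, norm_smul, smul_smul, mul_inv_cancel₀ hR.ne', one_smul, Real.norm_eq_abs,
        abs_of_pos hR', mul_pow, pow_mul, inv_pow R 2, mul_assoc]
    rw [h3]
    exact ⟨h1, h2⟩
  obtain ⟨i1, e1⟩ := key t ht0
  obtain ⟨i2, e2⟩ := key t⁻¹ (by positivity)
  rw [← e1, ← e2, ← integral_sub i1 i2]
  refine integral_congr_ae ?_
  filter_upwards [ae_ne_zero (n := 2 * (l + 2)) (by omega)] with z hz
  have hz : 0 < ‖z‖ := norm_pos_iff.2 hz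
  rw [iterLap_radial (smooth_diffLog (by positivity) hqp), radial,
    radIter_diffLog (by positivity) (by positivity) _ (by positivity), inv_pow t 2, inv_inv]
  simp only [profile]
  ring

/-- The dilates shrink to the origin while the profile keeps its mass -κ: this is how the Dirac mass
of the fundamental solution appears. -/
theorem tendsto_profile_near {g : EuclideanSpace ℝ (Fin (2 * (l + 2))) → ℝ} (hg : Continuous g) :
    Tendsto (fun k : ℕ => ∫ z, profile (2 * (l + 2)) (l + 2) (‖z‖ ^ 2) *
      g (((k : ℝ) + 1)⁻¹ • z)) atTop (𝓝 (-kappa (2 * (l + 2)) * g 0)) := by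
  obtain ⟨C, hC⟩ := (isCompact_closedBall (0 : EuclideanSpace ℝ (Fin (2 * (l + 2)))) 2
    ).exists_bound_of_continuousOn hg.continuousOn
  rw [← integral_profile, ← integral_mul_const]
  have hi : Integrable (fun z : EuclideanSpace ℝ (Fin (2 * (l + 2))) =>
      profile (2 * (l + 2)) (l + 2) (‖z‖ ^ 2)) := by
    simpa using integrable_profile_mul (l := l) (g := fun _ => 1) continuous_const
  have hlim : Tendsto (fun k : ℕ => ((k : ℝ) + 1)⁻¹) atTop (𝓝 0) :=
    tendsto_inv_atTop_zero.comp
      (tendsto_atTop_add_const_right _ _ tendsto_natCast_atTop_atTop)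
  refine tendsto_integral_of_dominated_convergence
    (fun z => ‖profile (2 * (l + 2)) (l + 2) (‖z‖ ^ 2)‖ * C) ?_ (hi.norm.mul_const _) ?_ ?_
  · exact fun k => (integrable_profile_mul (hg.comp (continuous_const_smul _))).aestronglyMeasurable
  · intro k
    refine Eventually.of_forall fun z => ?_
    rw [norm_mul]
    rcases le_or_gt 2 ‖z‖ with h | h
    · rw [profile_far _ h]; simp
    · refine mul_le_mul_of_nonneg_left (hC _ ?_) (norm_nonneg _)
      have h1 : ((k : ℝ) + 1)⁻¹ ≤ 1 := inv_le_one_of_one_le₀ (by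
        have : (0 : ℝ) ≤ k := k.cast_nonneg
        linarith)
      rw [Metric.mem_closedBall, dist_zero_right, norm_smul, Real.norm_eq_abs,
        abs_of_pos (by positivity)]
      nlinarith [norm_nonneg z]
  · refine Eventually.of_forall fun z => ?_
    refine Tendsto.const_mul _ ?_
    have h1 : Tendsto (fun k : ℕ => ((k : ℝ) + 1)⁻¹ • z) atTop (𝓝 0) := by
      simpa using hlim.smul_const z
    exact (hg.tendsto 0).comp h1

variable {u : EuclideanSpace ℝ (Fin (2 * (l + 2))) → ℝ}

/-- Here ∂ᵢu(Rz) = R⁻¹ ∂ᵢu_R(z), and ∇u_R is bounded in L²(B₂) uniformly in R, so the pairing is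
O(R⁻¹). This step excludes a polynomial part. -/
theorem tendsto_profile_far (hu : ContDiff ℝ ∞ u)
    (hF : Integrable (fun z => (max (confLap u z) 0) ^ (l + 2))) (i : Fin (2 * (l + 2))) :
    Tendsto (fun k : ℕ => ∫ z, profile (2 * (l + 2)) (l + 2) (‖z‖ ^ 2) *
      partialDeriv i u (((k : ℝ) + 1) • z)) atTop (𝓝 0) := by
  obtain ⟨B, hB0, hB⟩ := exists_gradSq_bound hu (by omega) rfl hF
  obtain ⟨C, hC0, hC⟩ := exists_profile_bound l
  set V := (volume : Measure (EuclideanSpace ℝ (Fin (2 * (l + 2))))).real (Metric.ball 0 2)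
  have hbound : ∀ k : ℕ, ‖∫ z, profile (2 * (l + 2)) (l + 2) (‖z‖ ^ 2) *
      partialDeriv i u (((k : ℝ) + 1) • z)‖ ≤ C * (V + B) * ((k : ℝ) + 1)⁻¹ := by
    intro k
    set R : ℝ := (k : ℝ) + 1
    have hR : 0 < R := by positivity
    have hw := rescale_smooth hu 0 R
    have hG : IntegrableOn (gradSq (rescale u 0 R)) (Metric.ball 0 2) :=
      ((continuous_gradSq hw).continuousOn.integrableOn_compact
        (isCompact_closedBall 0 2)).mono_set Metric.ball_subset_closedBall
    have hone : IntegrableOn (fun _ : EuclideanSpace ℝ (Fin (2 * (l + 2))) => (1 : ℝ))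
      (Metric.ball 0 2) := integrableOn_const (by finiteness)
    have hsub : ∫ z, profile (2 * (l + 2)) (l + 2) (‖z‖ ^ 2) * partialDeriv i u (R • z) =
        ∫ z in Metric.ball 0 2, profile (2 * (l + 2)) (l + 2) (‖z‖ ^ 2) *
          partialDeriv i u (R • z) := by
      refine (setIntegral_eq_integral_of_forall_compl_eq_zero fun z hz => ?_).symm
      rw [profile_far, zero_mul]
      simpa using hz
    rw [hsub]
    calc _ ≤ ∫ z in Metric.ball 0 2, C * R⁻¹ * (1 + gradSq (rescale u 0 R) z) := by
          refine norm_integral_le_of_norm_le ((hone.add hG).const_mul _) ?_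
          filter_upwards [ae_restrict_of_ae (ae_ne_zero (n := 2 * (l + 2)) (by omega))] with z hz
          have hz : 0 < ‖z‖ := norm_pos_iff.2 hz
          have h1 : partialDeriv i u (R • z) = R⁻¹ * partialDeriv i (rescale u 0 R) z := by
            rw [partialDeriv_rescale hu, zero_add, ← mul_assoc, inv_mul_cancel₀ hR.ne', one_mul]
          have h2 : (partialDeriv i (rescale u 0 R) z) ^ 2 ≤ gradSq (rescale u 0 R) z :=
            Finset.single_le_sum (f := fun i => (partialDeriv i (rescale u 0 R) z) ^ 2)
              (fun j _ => sq_nonneg _) (Finset.mem_univ i)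
          -- Passes from the L² bound to an L¹ bound on the ball at the cost of its volume V.
          have h3 : |partialDeriv i (rescale u 0 R) z| ≤ 1 + gradSq (rescale u 0 R) z := by
            rw [abs_le]
            constructor <;> nlinarith [sq_nonneg (partialDeriv i (rescale u 0 R) z - 1),
              sq_nonneg (partialDeriv i (rescale u 0 R) z + 1)]
          rw [h1, norm_mul, norm_mul, Real.norm_eq_abs, Real.norm_eq_abs, Real.norm_eq_abs,
            abs_of_pos (by positivity : 0 < R⁻¹)]
          calc _ ≤ C * (R⁻¹ * (1 + gradSq (rescale u 0 R) z)) := by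
                gcongr
                exact hC _ (by positivity)
            _ = _ := by ring
      _ = C * R⁻¹ * (V + ∫ z in Metric.ball 0 2, gradSq (rescale u 0 R) z) := by
          rw [integral_const_mul, integral_add hone hG]
          simp [V]
      _ ≤ C * R⁻¹ * (V + B) := by
          gcongr
          exact hB 0 R hR
      _ = _ := by ring
  refine squeeze_zero_norm hbound ?_
  have hlim : Tendsto (fun k : ℕ => ((k : ℝ) + 1)⁻¹) atTop (𝓝 0) :=
    tendsto_inv_atTop_zero.comp
      (tendsto_atTop_add_const_right _ _ tendsto_natCast_atTop_atTop)
  simpa using hlim.const_mul (C * (V + B))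

/-- Two evaluations of the limit of ∫ ∂ᵢL_k · f, with L_k a difference of truncated logarithms, are
equated: pointwise convergence of ∂ᵢL_k on one side, all derivatives transferred to L_k on the
other. -/
theorem gradient_representation_zero (hu : ContDiff ℝ ∞ u)
    (hF : Integrable (fun z => (max (confLap u z) 0) ^ (l + 2)))
    (hf : Integrable (iterLap (l + 2) u)) (i : Fin (2 * (l + 2))) :
    kappa (2 * (l + 2)) * partialDeriv i u 0 = ∫ z, field i z * iterLap (l + 2) u z := by
  have h1 := tendsto_integral_partialDeriv_diffLog (by omega)
    (iterLap_smooth hu (l + 2)).continuous hf i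
  have hg := continuous_partialDeriv hu i
  have h2 := ((tendsto_profile_far hu hF i).sub (tendsto_profile_near hg)).neg
  have h3 : ∀ k : ℕ, ∫ z, partialDeriv i (radial (2 * (l + 2))
      (diffLog (((k : ℝ) + 1) ^ 2) ((((k : ℝ) + 1) ^ 2)⁻¹))) z * iterLap (l + 2) u z =
      -((∫ z, profile (2 * (l + 2)) (l + 2) (‖z‖ ^ 2) * partialDeriv i u (((k : ℝ) + 1) • z)) -
        ∫ z, profile (2 * (l + 2)) (l + 2) (‖z‖ ^ 2) *
          partialDeriv i u (((k : ℝ) + 1)⁻¹ • z)) := by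
    intro k
    have ht : (1 : ℝ) ≤ (k : ℝ) + 1 := by
      have : (0 : ℝ) ≤ k := k.cast_nonneg
      linarith
    have hp1 : 1 ≤ ((k : ℝ) + 1) ^ 2 := by nlinarith
    have hqp : (((k : ℝ) + 1) ^ 2)⁻¹ ≤ ((k : ℝ) + 1) ^ 2 :=
      (inv_le_one_of_one_le₀ hp1).trans hp1
    have hq : 0 < (((k : ℝ) + 1) ^ 2)⁻¹ := by positivity
    rw [integral_partialDeriv_mul_iterLap (smooth_radial (smooth_diffLog hq hqp))
      (radial_diffLog_hasCompactSupport _ hq hqp) hu, integral_iterLap_diffLog_mul hg ht]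
  simp only [h3] at h1
  have := tendsto_nhds_unique h1 h2
  linarith

theorem gradient_representation (hu : ContDiff ℝ ∞ u)
    (hF : Integrable (fun z => (max (confLap u z) 0) ^ (l + 2)))
    (hf : Integrable (iterLap (l + 2) u)) (i : Fin (2 * (l + 2)))
    (x : EuclideanSpace ℝ (Fin (2 * (l + 2)))) :
    kappa (2 * (l + 2)) * partialDeriv i u x = ∫ y, field i (y - x) * iterLap (l + 2) u y := by
  have h := gradient_representation_zero (rescale_smooth hu x 1)
    (by
      simp only [max_confLap_rescale_pow hu rfl x one_pos]
      exact integrable_comp_affine hF x one_pos)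
    (by
      rw [iterLap_translate hu]
      refine (hf.comp_add_left x).congr (Eventually.of_forall fun z => ?_)
      simp [rescale]) i
  rw [partialDeriv_rescale hu, iterLap_translate hu] at h
  simp only [rescale, one_mul, smul_zero, add_zero, one_smul] at h
  rw [h, ← integral_add_left_eq_self (fun y => field i (y - x) * iterLap (l + 2) u y) x]
  simp

end Profile

end Representation

open scoped ENNReal

/-! ### Kernel estimates for the behaviour of ∇u at infinity -/

section Asymptotics

variable {n : ℕ}

theorem norm_inversion_sub {E : Type*} [NormedAddCommGroup E] [InnerProductSpace ℝ E] {a b : E}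
    (ha : a ≠ 0) (hb : b ≠ 0) :
    ‖(‖a‖ ^ 2)⁻¹ • a - (‖b‖ ^ 2)⁻¹ • b‖ = ‖a - b‖ / (‖a‖ * ‖b‖) := by
  have ha' : 0 < ‖a‖ := norm_pos_iff.2 ha
  have hb' : 0 < ‖b‖ := norm_pos_iff.2 hb
  rw [← sq_eq_sq₀ (norm_nonneg _) (by positivity), norm_sub_sq_real, div_pow, norm_sub_sq_real,
    norm_smul, norm_smul, inner_smul_left, inner_smul_right]
  simp
  field_simp
  ring

theorem mul_field_smul (i : Fin n) {R : ℝ} (hR : 0 < R) (z : EuclideanSpace ℝ (Fin n)) :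
    R * field i (R • z) = field i z := by
  rcases eq_or_ne z 0 with rfl | h0
  · simp [field]
  · have : 0 < ‖z‖ := norm_pos_iff.2 h0
    simp only [field, norm_smul, Real.norm_eq_abs, abs_of_pos hR, PiLp.smul_apply, smul_eq_mul]
    field_simp

/-- The sum is a component of the difference of the inversions of w - ξ and -ξ, which differ by w.
The inversion identity therefore extracts the factor ‖w‖ that gives decay as w → 0. -/
theorem sq_field_add_le (i : Fin n) {w ξ : EuclideanSpace ℝ (Fin n)} (hξ : ξ ≠ 0) (hw : w ≠ ξ) :
    (field i (w - ξ) + field i ξ) ^ 2 ≤ ‖w‖ ^ 2 / (‖ξ‖ ^ 2 * ‖w - ξ‖ ^ 2) := by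
  have h := norm_inversion_sub (sub_ne_zero.2 hw) (neg_ne_zero.2 hξ)
  have h1 := abs_coord_le_norm
    ((‖w - ξ‖ ^ 2)⁻¹ • (w - ξ) - (‖-ξ‖ ^ 2)⁻¹ • (-ξ)) i
  rw [h] at h1
  have h2 : ((‖w - ξ‖ ^ 2)⁻¹ • (w - ξ) - (‖-ξ‖ ^ 2)⁻¹ • (-ξ)) i = field i (w - ξ) + field i ξ := by
    simp only [field, PiLp.sub_apply, PiLp.smul_apply, PiLp.neg_apply, norm_neg, smul_eq_mul]
    ring
  rw [h2, sub_neg_eq_add, sub_add_cancel, norm_neg] at h1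
  rw [← sq_abs]
  calc _ ≤ (‖w‖ / (‖w - ξ‖ * ‖ξ‖)) ^ 2 := by gcongr
    _ = _ := by rw [div_pow, mul_pow, mul_comm (‖w - ξ‖ ^ 2)]

/-- The closed annulus `1 ≤ ‖ξ‖ ≤ 2`. -/
def annulus (n : ℕ) : Set (EuclideanSpace ℝ (Fin n)) := {ξ | 1 ≤ ‖ξ‖ ∧ ‖ξ‖ ≤ 2}

theorem isCompact_annulus : IsCompact (annulus n) := by
  have h : annulus n = Metric.closedBall 0 2 ∩ {ξ | 1 ≤ ‖ξ‖} := by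
    ext ξ; simp [annulus, and_comm]
  rw [h]
  exact (isCompact_closedBall _ _).inter_right (isClosed_le continuous_const continuous_norm)

theorem measurableSet_annulus : MeasurableSet (annulus n) := isCompact_annulus.isClosed.measurableSet

theorem ne_zero_of_mem_annulus {ξ : EuclideanSpace ℝ (Fin n)} (h : ξ ∈ annulus n) : ξ ≠ 0 := by
  rintro rfl
  have := h.1
  norm_num at this

/-- The comparison kernel `‖w‖² / (‖ξ‖² ‖w - ξ‖²)`. -/
noncomputable def cmpKer (w ξ : EuclideanSpace ℝ (Fin n)) : ℝ≥0∞ :=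
  ENNReal.ofReal (‖w‖ ^ 2 / (‖ξ‖ ^ 2 * ‖w - ξ‖ ^ 2))

theorem measurable_cmpKer : Measurable (fun p : EuclideanSpace ℝ (Fin n) ×
    EuclideanSpace ℝ (Fin n) => cmpKer p.1 p.2) := by
  unfold cmpKer
  fun_prop

/-- Split at distance 1: the near part is a translate of a locally integrable function, the far part
is at most 1 on a set of finite volume. Hence uniformity in w. -/
theorem exists_lintegral_norm_sub_bound (hn : 3 ≤ n) : ∃ C : ℝ≥0∞, C ≠ ⊤ ∧
    ∀ w : EuclideanSpace ℝ (Fin n),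
      ∫⁻ ξ in annulus n, ENNReal.ofReal ((‖w - ξ‖ ^ 2)⁻¹) ≤ C := by
  set g : EuclideanSpace ℝ (Fin n) → ℝ≥0∞ :=
    (Metric.ball 0 1).indicator fun z => ENNReal.ofReal ((‖z‖ ^ 2)⁻¹) with hg
  have hgm : Measurable g := Measurable.indicator (by fun_prop) measurableSet_ball
  refine ⟨(∫⁻ z, g z) + volume (annulus n), ?_, fun w => ?_⟩
  · refine ENNReal.add_ne_top.2 ⟨?_, isCompact_annulus.measure_lt_top.ne⟩
    rw [hg, lintegral_indicator measurableSet_ball]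
    exact (integrableOn_norm_sq_inv hn 1).lintegral_lt_top.ne
  · calc ∫⁻ ξ in annulus n, ENNReal.ofReal ((‖w - ξ‖ ^ 2)⁻¹)
        ≤ ∫⁻ ξ in annulus n, (g (w - ξ) + 1) := by
          refine lintegral_mono fun ξ => ?_
          by_cases h : w - ξ ∈ Metric.ball (0 : EuclideanSpace ℝ (Fin n)) 1
          · rw [hg, indicator_of_mem h]; exact le_self_add
          · refine le_add_of_le_right ?_
            have h1 : 1 ≤ ‖w - ξ‖ := by simpa using h
            rw [ENNReal.ofReal_le_one]
            exact inv_le_one_of_one_le₀ (one_le_pow₀ h1)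
      _ = (∫⁻ ξ in annulus n, g (w - ξ)) + volume (annulus n) := by
          rw [lintegral_add_right _ measurable_const, setLIntegral_one]
      _ ≤ (∫⁻ ξ, g (w - ξ)) + volume (annulus n) := by
          gcongr
          exact Measure.restrict_le_self
      _ = _ := by rw [lintegral_sub_left_eq_self g w]

/-- The first bound serves as the dominating constant, the second gives convergence to zero as w →
0. -/
theorem exists_lintegral_cmpKer_bound (hn : 3 ≤ n) : ∃ C : ℝ≥0∞, C ≠ ⊤ ∧
    ∀ w : EuclideanSpace ℝ (Fin n), ∫⁻ ξ in annulus n, cmpKer w ξ ≤ C ∧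
      ∫⁻ ξ in annulus n, cmpKer w ξ ≤ ENNReal.ofReal (‖w‖ ^ 2) * C := by
  obtain ⟨C₁, hC₁, hb⟩ := exists_lintegral_norm_sub_bound hn
  have hsmall : ∀ w : EuclideanSpace ℝ (Fin n),
      ∫⁻ ξ in annulus n, cmpKer w ξ ≤ ENNReal.ofReal (‖w‖ ^ 2) * C₁ := by
    intro w
    refine le_trans ?_ (mul_le_mul_right (hb w) _)
    rw [← lintegral_const_mul _ (by fun_prop)]
    refine setLIntegral_mono' measurableSet_annulus fun ξ hξ => ?_
    rw [cmpKer, ← ENNReal.ofReal_mul (by positivity)]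
    refine ENNReal.ofReal_le_ofReal ?_
    rw [div_eq_mul_inv, mul_inv]
    refine mul_le_mul_of_nonneg_left (mul_le_of_le_one_left (by positivity) ?_) (by positivity)
    exact inv_le_one_of_one_le₀ (one_le_pow₀ hξ.1)
  refine ⟨16 * C₁ + 4 * volume (annulus n), ?_, fun w => ⟨?_, ?_⟩⟩
  · exact ENNReal.add_ne_top.2 ⟨ENNReal.mul_ne_top (by norm_num) hC₁,
      ENNReal.mul_ne_top (by norm_num) isCompact_annulus.measure_lt_top.ne⟩
  -- For ‖w‖ ≥ 4 and ‖ξ‖ ≤ 2 one has ‖w - ξ‖ ≥ ‖w‖/2, so the kernel is at most 4; otherwise ‖w‖² ≤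
  -- 16.
  · rcases le_or_gt 4 ‖w‖ with h | h
    · refine le_add_of_le_right ?_
      rw [← setLIntegral_const]
      refine setLIntegral_mono' measurableSet_annulus fun ξ hξ => ?_
      rw [cmpKer]
      refine ENNReal.ofReal_le_of_le_toReal ?_
      have h1 : ‖w‖ / 2 ≤ ‖w - ξ‖ := by
        have := norm_sub_norm_le w ξ
        have := hξ.2
        linarith
      have h2 : ‖w‖ ^ 2 / 4 ≤ ‖w - ξ‖ ^ 2 := by nlinarith
      have h3 : 1 ≤ ‖ξ‖ ^ 2 := one_le_pow₀ hξ.1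
      have h4 : 0 < ‖w‖ ^ 2 := by positivity
      norm_num
      rw [div_le_iff₀ (by nlinarith)]
      nlinarith
    · refine le_add_of_le_left ((hsmall w).trans ?_)
      gcongr
      refine ENNReal.ofReal_le_of_le_toReal ?_
      norm_num
      nlinarith [norm_nonneg w]
  · refine (hsmall w).trans ?_
    gcongr
    exact le_add_of_le_left (le_mul_of_one_le_left' (by norm_num))

theorem sq_lintegral_le {α : Type*} [MeasurableSpace α] (ν : Measure α) {φ : α → ℝ≥0∞}
    (hφ : AEMeasurable φ ν) : (∫⁻ y, φ y ∂ν) ^ 2 ≤ ν univ * ∫⁻ y, φ y ^ 2 ∂ν := by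
  have h := ENNReal.lintegral_mul_le_Lp_mul_Lq ν Real.HolderConjugate.two_two
    (f := fun _ => 1) aemeasurable_const hφ
  simp only [Pi.mul_apply, one_mul, ENNReal.one_rpow, lintegral_one] at h
  calc (∫⁻ y, φ y ∂ν) ^ 2
      ≤ (ν univ ^ (1 / (2 : ℝ)) * (∫⁻ y, φ y ^ (2 : ℝ) ∂ν) ^ (1 / (2 : ℝ))) ^ 2 := by
        gcongr
    _ = _ := by
        rw [mul_pow, ← ENNReal.rpow_natCast, ← ENNReal.rpow_natCast, ← ENNReal.rpow_mul,
          ← ENNReal.rpow_mul]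
        norm_num

/-! ### L² convergence of rescaled gradients on the annulus -/

section Deviation

variable {l : ℕ} {u : EuclideanSpace ℝ (Fin (2 * (l + 2))) → ℝ}

/-- The deviation of the rescaled gradient from that of `-α log ‖ξ‖`. -/
noncomputable def deviation (u : EuclideanSpace ℝ (Fin n) → ℝ) (α R : ℝ) (i : Fin n)
    (ξ : EuclideanSpace ℝ (Fin n)) : ℝ :=
  R * partialDeriv i u (R • ξ) + α * field i ξ

theorem integrable_field_mul (hn : 3 ≤ n) {f : EuclideanSpace ℝ (Fin n) → ℝ} (hf : Continuous f)
    (hfi : Integrable f) (i : Fin n) (x : EuclideanSpace ℝ (Fin n)) :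
    Integrable (fun y => field i (y - x) * f y) := by
  have h := integrable_mul_norm_inv hn (f := fun y => f (x + y)) (by fun_prop) (hfi.comp_add_left x)
  have h2 : Integrable (fun y => field i y * f (x + y)) := by
    refine h.mono' ((measurable_field i).mul (by fun_prop)).aestronglyMeasurable
      (Eventually.of_forall fun y => ?_)
    rw [norm_mul, mul_comm]
    exact mul_le_mul_of_nonneg_left (abs_field_le i y) (norm_nonneg _)
  simpa using h2.comp_sub_right x

theorem kappa_pos (l : ℕ) : 0 < kappa (2 * (l + 2)) := by
  rw [kappa_eq]
  have h : 0 < (volume : Measure (EuclideanSpace ℝ (Fin (2 * (l + 2))))).real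
      (Metric.ball 0 1) :=
    ENNReal.toReal_pos (Metric.measure_ball_pos _ _ one_pos).ne' measure_ball_lt_top.ne
  positivity

/-- Since κα = ∫ f, the model term enters the representation integral as the kernel value at y = 0,
up to sign. -/
theorem kappa_mul_deviation (hu : ContDiff ℝ ∞ u)
    (hF : Integrable (fun z => (max (confLap u z) 0) ^ (l + 2)))
    (hf : Integrable (iterLap (l + 2) u)) (i : Fin (2 * (l + 2))) {R : ℝ} (hR : 0 < R)
    (ξ : EuclideanSpace ℝ (Fin (2 * (l + 2)))) :
    kappa (2 * (l + 2)) *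
        deviation u ((∫ y, iterLap (l + 2) u y) / kappa (2 * (l + 2))) R i ξ =
      ∫ y, (field i (R⁻¹ • y - ξ) + field i ξ) * iterLap (l + 2) u y := by
  have hk := (kappa_pos l).ne'
  have h1 := gradient_representation hu hF hf i (R • ξ)
  have hint := integrable_field_mul (by omega) (iterLap_smooth hu (l + 2)).continuous hf i (R • ξ)
  have h2 : ∀ y, field i (R⁻¹ • y - ξ) = R * field i (y - R • ξ) := by
    intro y
    rw [← mul_field_smul i hR, smul_sub, smul_smul, mul_inv_cancel₀ hR.ne', one_smul]
  have h3 : ∀ y, (field i (R⁻¹ • y - ξ) + field i ξ) * iterLap (l + 2) u y =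
      R * (field i (y - R • ξ) * iterLap (l + 2) u y) + field i ξ * iterLap (l + 2) u y := by
    intro y
    rw [h2]
    ring
  simp only [h3]
  rw [integral_add (hint.const_mul R) (hf.const_mul _), integral_const_mul, integral_const_mul,
    ← h1, deviation]
  field_simp

/-- Cauchy–Schwarz in y for the finite measure |f| dy, then Tonelli: the ξ-integral of the
comparison kernel is bounded uniformly and tends to 0 for each fixed y, because y/R → 0. Dominated
convergence concludes. -/
theorem tendsto_lintegral_deviation (hu : ContDiff ℝ ∞ u)
    (hF : Integrable (fun z => (max (confLap u z) 0) ^ (l + 2)))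
    (hf : Integrable (iterLap (l + 2) u)) (i : Fin (2 * (l + 2))) :
    Tendsto (fun R => ∫⁻ ξ in annulus (2 * (l + 2)), ‖kappa (2 * (l + 2)) *
      deviation u ((∫ y, iterLap (l + 2) u y) / kappa (2 * (l + 2))) R i ξ‖ₑ ^ 2) atTop (𝓝 0) := by
  set f := iterLap (l + 2) u with hfdef
  have hfm : Measurable (fun y => ‖f y‖ₑ) :=
    (iterLap_smooth hu (l + 2)).continuous.measurable.enorm
  set ν := (volume : Measure (EuclideanSpace ℝ (Fin (2 * (l + 2))))).withDensity
    (fun y => ‖f y‖ₑ) with hν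
  have : IsFiniteMeasure ν := isFiniteMeasure_withDensity hf.2.ne
  obtain ⟨C, hC, hCb⟩ := exists_lintegral_cmpKer_bound (n := 2 * (l + 2)) (by omega)
  have hmeas : ∀ R : ℝ, Measurable (fun p : EuclideanSpace ℝ (Fin (2 * (l + 2))) ×
      EuclideanSpace ℝ (Fin (2 * (l + 2))) => cmpKer (R⁻¹ • p.1) p.2) := fun R =>
    measurable_cmpKer.comp (f := fun p : EuclideanSpace ℝ (Fin (2 * (l + 2))) ×
      EuclideanSpace ℝ (Fin (2 * (l + 2))) => (R⁻¹ • p.1, p.2)) (by fun_prop)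
  have hupper : Tendsto (fun R : ℝ => ν univ *
      ∫⁻ y, (∫⁻ ξ in annulus (2 * (l + 2)), cmpKer (R⁻¹ • y) ξ) ∂ν) atTop (𝓝 0) := by
    rw [← mul_zero (ν univ), ← lintegral_zero (μ := ν)]
    refine ENNReal.Tendsto.const_mul ?_ (Or.inr (measure_ne_top _ _))
    refine tendsto_lintegral_filter_of_dominated_convergence (fun _ => C) ?_ ?_ ?_ ?_
    · exact Eventually.of_forall fun R => (hmeas R).lintegral_prod_right'
    · exact Eventually.of_forall fun R => Eventually.of_forall fun y => (hCb _).1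
    · rw [lintegral_const]
      exact ENNReal.mul_ne_top hC (measure_ne_top _ _)
    · refine Eventually.of_forall fun y => ?_
      refine tendsto_of_tendsto_of_tendsto_of_le_of_le tendsto_const_nhds
        (h := fun R : ℝ => ENNReal.ofReal (‖R⁻¹ • y‖ ^ 2) * C) ?_ (fun _ => zero_le)
        (fun R => (hCb _).2)
      have h1 : Tendsto (fun R : ℝ => ‖R⁻¹ • y‖ ^ 2) atTop (𝓝 0) := by
        have := ((tendsto_inv_atTop_zero (𝕜 := ℝ)).smul_const y).norm.pow 2
        simpa using this
      have h2 := ENNReal.Tendsto.mul_const (b := C) (ENNReal.tendsto_ofReal h1) (Or.inr hC)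
      simpa using h2
  refine tendsto_of_tendsto_of_tendsto_of_le_of_le' tendsto_const_nhds hupper
    (Eventually.of_forall fun _ => zero_le) ?_
  filter_upwards [eventually_gt_atTop 0] with R hR
  rw [lintegral_lintegral_swap (f := fun y ξ => cmpKer (R⁻¹ • y) ξ) (hmeas R).aemeasurable]
  rw [← lintegral_const_mul' _ _ (measure_ne_top _ _)]
  refine setLIntegral_mono' measurableSet_annulus fun ξ hξ => ?_
  rw [kappa_mul_deviation hu hF hf i hR]
  have hK : Measurable fun y => field i (R⁻¹ • y - ξ) + field i ξ :=
    ((measurable_field i).comp (by fun_prop)).add_const _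
  calc ‖∫ y, (field i (R⁻¹ • y - ξ) + field i ξ) * f y‖ₑ ^ 2
      ≤ (∫⁻ y, ‖(field i (R⁻¹ • y - ξ) + field i ξ) * f y‖ₑ) ^ 2 := by
        gcongr
        exact enorm_integral_le_lintegral_enorm _
    _ = (∫⁻ y, ‖field i (R⁻¹ • y - ξ) + field i ξ‖ₑ ∂ν) ^ 2 := by
        rw [hν, lintegral_withDensity_eq_lintegral_mul _ hfm hK.enorm]
        simp [enorm_mul, mul_comm]
    _ ≤ ν univ * ∫⁻ y, ‖field i (R⁻¹ • y - ξ) + field i ξ‖ₑ ^ 2 ∂ν :=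
        sq_lintegral_le ν hK.enorm.aemeasurable
    _ ≤ _ := by
        refine mul_le_mul' le_rfl (lintegral_mono_ae ((withDensity_absolutelyContinuous _ _).ae_le ?_))
        -- The inversion estimate fails only at the singular point y = Rξ, a null set also for |f|
        -- dy.
        have hne : ∀ᵐ y : EuclideanSpace ℝ (Fin (2 * (l + 2))), y - R • ξ ≠ 0 := by
          have h0 := ae_ne_zero (n := 2 * (l + 2)) (by omega)
          exact (measurePreserving_sub_right volume (R • ξ)).quasiMeasurePreserving.ae h0
        filter_upwards [hne] with y hy
        have hne : R⁻¹ • y ≠ ξ := by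
          rintro rfl
          apply hy
          rw [smul_smul, mul_inv_cancel₀ hR.ne', one_smul, sub_self]
        rw [cmpKer, Real.enorm_eq_ofReal_abs, ← ENNReal.ofReal_pow (abs_nonneg _), sq_abs]
        exact ENNReal.ofReal_le_ofReal (sq_field_add_le i (ne_zero_of_mem_annulus hξ) hne)

theorem continuousOn_field (i : Fin n) : ContinuousOn (field i) (annulus n) := by
  refine ContinuousOn.div (differentiable_coord i).continuous.continuousOn
    (continuous_norm.pow 2).continuousOn fun ξ hξ => ?_
  have := norm_pos_iff.2 (ne_zero_of_mem_annulus hξ)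
  positivity

theorem continuousOn_deviation {u : EuclideanSpace ℝ (Fin n) → ℝ} (hu : ContDiff ℝ ∞ u) (α R : ℝ)
    (i : Fin n) : ContinuousOn (deviation u α R i) (annulus n) :=
  ((continuous_const.mul ((continuous_partialDeriv hu i).comp
    (continuous_const_smul R))).continuousOn).add (continuousOn_const.mul (continuousOn_field i))

theorem integrableOn_annulus {g : EuclideanSpace ℝ (Fin n) → ℝ} (hg : ContinuousOn g (annulus n)) :
    IntegrableOn g (annulus n) := hg.integrableOn_compact isCompact_annulus

theorem tendsto_integral_sq_deviation (hu : ContDiff ℝ ∞ u)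
    (hF : Integrable (fun z => (max (confLap u z) 0) ^ (l + 2)))
    (hf : Integrable (iterLap (l + 2) u)) (i : Fin (2 * (l + 2))) :
    Tendsto (fun R => ∫ ξ in annulus (2 * (l + 2)),
      (deviation u ((∫ y, iterLap (l + 2) u y) / kappa (2 * (l + 2))) R i ξ) ^ 2) atTop (𝓝 0) := by
  have h := (ENNReal.tendsto_toReal ENNReal.zero_ne_top).comp
    (tendsto_lintegral_deviation hu hF hf i)
  have hk := (kappa_pos l).ne'
  have h2 := h.const_mul ((kappa (2 * (l + 2)) ^ 2)⁻¹)
  simp only [ENNReal.toReal_zero, mul_zero] at h2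
  refine h2.congr fun R => ?_
  set d := deviation u ((∫ y, iterLap (l + 2) u y) / kappa (2 * (l + 2))) R i
  have hd : ContinuousOn (fun ξ => (kappa (2 * (l + 2)) * d ξ) ^ 2) (annulus (2 * (l + 2))) :=
    (continuousOn_const.mul (continuousOn_deviation hu _ R i)).pow 2
  have h3 : ∫ ξ in annulus (2 * (l + 2)), (kappa (2 * (l + 2)) * d ξ) ^ 2 =
      (∫⁻ ξ in annulus (2 * (l + 2)), ‖kappa (2 * (l + 2)) * d ξ‖ₑ ^ 2).toReal := by
    rw [integral_eq_lintegral_of_nonneg_ae (Eventually.of_forall fun ξ => sq_nonneg _)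
      (hd.aestronglyMeasurable measurableSet_annulus)]
    congr 1
    refine lintegral_congr fun ξ => ?_
    rw [Real.enorm_eq_ofReal_abs, ← ENNReal.ofReal_pow (abs_nonneg _), sq_abs]
  simp only [Function.comp_apply]
  rw [← h3]
  simp only [mul_pow]
  rw [integral_const_mul]
  field_simp

end Deviation

end Asymptotics

/-! ### Passing to the limit in the curvature expression -/

section BlowDown

variable {n : ℕ}

/-- Nonnegativity of ∫ (g + th)² for all t, read through the discriminant. -/
theorem sq_setIntegral_mul_le {g h : EuclideanSpace ℝ (Fin n) → ℝ}
    (hg : ContinuousOn g (annulus n)) (hh : ContinuousOn h (annulus n)) :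
    (∫ ξ in annulus n, g ξ * h ξ) ^ 2 ≤
      (∫ ξ in annulus n, g ξ ^ 2) * ∫ ξ in annulus n, h ξ ^ 2 := by
  have ig := integrableOn_annulus (hg.pow 2)
  have ih := integrableOn_annulus (hh.pow 2)
  have igh := integrableOn_annulus (hg.mul hh)
  have key : ∀ t : ℝ, 0 ≤ (∫ ξ in annulus n, h ξ ^ 2) * (t * t) +
      (2 * ∫ ξ in annulus n, g ξ * h ξ) * t + ∫ ξ in annulus n, g ξ ^ 2 := by
    intro t
    have h1 : ∫ ξ in annulus n, (g ξ + t * h ξ) ^ 2 =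
        (∫ ξ in annulus n, h ξ ^ 2) * (t * t) +
      (2 * ∫ ξ in annulus n, g ξ * h ξ) * t + ∫ ξ in annulus n, g ξ ^ 2 := by
      have h2 : ∀ ξ, (g ξ + t * h ξ) ^ 2 = t * t * h ξ ^ 2 + 2 * t * (g ξ * h ξ) + g ξ ^ 2 :=
        fun ξ => by ring
      simp only [h2]
      have e1 := integral_add ((ih.const_mul (t * t)).add (igh.const_mul (2 * t))) ig
      have e2 := integral_add (ih.const_mul (t * t)) (igh.const_mul (2 * t))
      simp only [Pi.add_apply, Pi.pow_apply, Pi.mul_apply] at e1 e2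
      rw [e1, e2, integral_const_mul, integral_const_mul]
      ring
    rw [← h1]
    exact integral_nonneg fun ξ => sq_nonneg _
  have := discrim_le_zero key
  rw [discrim] at this
  nlinarith

theorem tendsto_setIntegral_mul {d : ℝ → EuclideanSpace ℝ (Fin n) → ℝ}
    (hd : ∀ R, ContinuousOn (d R) (annulus n))
    (hlim : Tendsto (fun R => ∫ ξ in annulus n, d R ξ ^ 2) atTop (𝓝 0))
    {χ : EuclideanSpace ℝ (Fin n) → ℝ} (hχ : ContinuousOn χ (annulus n)) :
    Tendsto (fun R => ∫ ξ in annulus n, χ ξ * d R ξ) atTop (𝓝 0) := by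
  have h1 : Tendsto (fun R => (∫ ξ in annulus n, χ ξ * d R ξ) ^ 2) atTop (𝓝 0) := by
    refine squeeze_zero (fun _ => sq_nonneg _) (fun R => sq_setIntegral_mul_le hχ (hd R)) ?_
    simpa using hlim.const_mul (∫ ξ in annulus n, χ ξ ^ 2)
  have h2 := h1.sqrt
  simp only [Real.sqrt_sq_eq_abs, Real.sqrt_zero] at h2
  exact (tendsto_zero_iff_abs_tendsto_zero _).2 h2

theorem tendsto_setIntegral_mul_sq {d : ℝ → EuclideanSpace ℝ (Fin n) → ℝ}
    (hd : ∀ R, ContinuousOn (d R) (annulus n))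
    (hlim : Tendsto (fun R => ∫ ξ in annulus n, d R ξ ^ 2) atTop (𝓝 0))
    {χ : EuclideanSpace ℝ (Fin n) → ℝ} (hχ : Continuous χ) (h0 : ∀ ξ, 0 ≤ χ ξ)
    (h1 : ∀ ξ, χ ξ ≤ 1) :
    Tendsto (fun R => ∫ ξ in annulus n, χ ξ * d R ξ ^ 2) atTop (𝓝 0) := by
  refine squeeze_zero (fun R => integral_nonneg fun ξ => mul_nonneg (h0 ξ) (sq_nonneg _))
    (fun R => ?_) hlim
  exact integral_mono (integrableOn_annulus (hχ.continuousOn.mul ((hd R).pow 2)))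
    (integrableOn_annulus ((hd R).pow 2))
    fun ξ => mul_le_of_le_one_left (sq_nonneg _) (h1 ξ)

/-- A smooth bump supported in the annulus. -/
structure AnnularBump (n : ℕ) where
  /-- The underlying function. -/
  toFun : EuclideanSpace ℝ (Fin n) → ℝ
  smooth : ContDiff ℝ ∞ toFun
  nonneg : ∀ ξ, 0 ≤ toFun ξ
  le_one : ∀ ξ, toFun ξ ≤ 1
  tsupport_subset : tsupport toFun ⊆ annulus n
  integral_pos : 0 < ∫ ξ, toFun ξ

theorem exists_annularBump (hn : 1 ≤ n) : Nonempty (AnnularBump n) := by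
  set c : EuclideanSpace ℝ (Fin n) := EuclideanSpace.single ⟨0, hn⟩ (3 / 2 : ℝ) with hc
  have hcn : ‖c‖ = 3 / 2 := by rw [hc]; simp [PiLp.norm_single]
  let b : ContDiffBump c := ⟨1 / 4, 1 / 2, by norm_num, by norm_num⟩
  refine ⟨⟨b, b.contDiff, fun _ => b.nonneg, fun _ => b.le_one, ?_, b.integral_pos⟩⟩
  rw [b.tsupport_eq]
  intro ξ hξ
  have h : ‖ξ - c‖ ≤ 1 / 2 := by simpa [dist_eq_norm, b] using hξ
  have h1 := norm_sub_norm_le c ξ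
  have h2 := norm_sub_norm_le ξ c
  rw [norm_sub_rev] at h1
  constructor <;> linarith

namespace AnnularBump

variable (ψ : AnnularBump n)

theorem hasCompactSupport : HasCompactSupport ψ.toFun :=
  isCompact_annulus.of_isClosed_subset (isClosed_tsupport _) ψ.tsupport_subset

theorem eq_zero {ξ : EuclideanSpace ℝ (Fin n)} (h : ξ ∉ annulus n) : ψ.toFun ξ = 0 :=
  image_eq_zero_of_notMem_tsupport fun h' => h (ψ.tsupport_subset h')

theorem partialDeriv_eq_zero (i : Fin n) {ξ : EuclideanSpace ℝ (Fin n)} (h : ξ ∉ annulus n) :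
    partialDeriv i ψ.toFun ξ = 0 := by
  have : ξ ∉ tsupport ψ.toFun := fun h' => h (ψ.tsupport_subset h')
  have h2 : fderiv ℝ ψ.toFun ξ = 0 := by
    by_contra h'
    exact this (support_fderiv_subset ℝ h')
  simp [partialDeriv, h2]

theorem integral_mul_eq (g : EuclideanSpace ℝ (Fin n) → ℝ) :
    ∫ ξ, ψ.toFun ξ * g ξ = ∫ ξ in annulus n, ψ.toFun ξ * g ξ :=
  (setIntegral_eq_integral_of_forall_compl_eq_zero fun ξ h => by
    rw [ψ.eq_zero h, zero_mul]).symm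

theorem integral_partialDeriv_mul_eq (i : Fin n) (g : EuclideanSpace ℝ (Fin n) → ℝ) :
    ∫ ξ, partialDeriv i ψ.toFun ξ * g ξ = ∫ ξ in annulus n, partialDeriv i ψ.toFun ξ * g ξ :=
  (setIntegral_eq_integral_of_forall_compl_eq_zero fun ξ h => by
    rw [ψ.partialDeriv_eq_zero i h, zero_mul]).symm

theorem integral_eq : ∫ ξ, ψ.toFun ξ = ∫ ξ in annulus n, ψ.toFun ξ :=
  (setIntegral_eq_integral_of_forall_compl_eq_zero fun _ h => ψ.eq_zero h).symm

theorem integrable_mul {g : EuclideanSpace ℝ (Fin n) → ℝ} (hg : Continuous g) :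
    Integrable (fun ξ => ψ.toFun ξ * g ξ) :=
  (ψ.smooth.continuous.mul hg).integrable_of_hasCompactSupport ψ.hasCompactSupport.mul_right

theorem integrable : Integrable ψ.toFun :=
  ψ.smooth.continuous.integrable_of_hasCompactSupport ψ.hasCompactSupport

theorem integrableOn_div : IntegrableOn (fun ξ => ψ.toFun ξ / ‖ξ‖ ^ 2) (annulus n) := by
  refine integrableOn_annulus (ψ.smooth.continuous.continuousOn.div
    (continuous_norm.pow 2).continuousOn fun ξ hξ => ?_)
  have := norm_pos_iff.2 (ne_zero_of_mem_annulus hξ)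
  positivity

theorem integral_div_pos : 0 < ∫ ξ in annulus n, ψ.toFun ξ / ‖ξ‖ ^ 2 := by
  have h1 : ∫ ξ in annulus n, ψ.toFun ξ * (1 / 4) ≤ ∫ ξ in annulus n, ψ.toFun ξ / ‖ξ‖ ^ 2 := by
    refine setIntegral_mono_on (ψ.integrable.mul_const _).integrableOn ψ.integrableOn_div
      measurableSet_annulus fun ξ hξ => ?_
    have := norm_pos_iff.2 (ne_zero_of_mem_annulus hξ)
    rw [div_eq_mul_inv (ψ.toFun ξ), one_div]
    refine mul_le_mul_of_nonneg_left ?_ (ψ.nonneg ξ)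
    exact inv_anti₀ (by positivity) (by nlinarith [hξ.2])
  rw [integral_mul_const, ← ψ.integral_eq] at h1
  have := ψ.integral_pos
  linarith

end AnnularBump

theorem sum_field_sq {ξ : EuclideanSpace ℝ (Fin n)} (hξ : ξ ≠ 0) :
    ∑ i, field i ξ ^ 2 = 1 / ‖ξ‖ ^ 2 := by
  have := norm_pos_iff.2 hξ
  simp only [field, div_pow, ← Finset.sum_div]
  rw [← EuclideanSpace.real_norm_sq_eq]
  field_simp

variable {l : ℕ} {u : EuclideanSpace ℝ (Fin (2 * (l + 2))) → ℝ}

/-- Integration by parts for log ‖ξ‖, with Δ log ‖ξ‖ = (n-2)/‖ξ‖² and n - 2 = 2l + 2. -/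
theorem AnnularBump.sum_integral_partialDeriv_mul_field (ψ : AnnularBump (2 * (l + 2))) :
    ∑ i, ∫ ξ in annulus (2 * (l + 2)), partialDeriv i ψ.toFun ξ * field i ξ =
      -((2 * l + 2) * ∫ ξ in annulus (2 * (l + 2)), ψ.toFun ξ / ‖ξ‖ ^ 2) := by
  -- A globally smooth stand-in for -log ‖ξ‖: on the annulus 1 ≤ ‖ξ‖² ≤ 4, so ‖ξ‖²/8 < 1 and 8‖ξ‖² >
  -- 2, and the difference of truncated logarithms equals -log ‖ξ‖ plus a constant.
  have hq : (0 : ℝ) < 1 / 8 := by norm_num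
  have hqp : (1 / 8 : ℝ) ≤ 8 := by norm_num
  have hL : ContDiff ℝ ∞ (radial (2 * (l + 2)) (diffLog 8 (1 / 8))) :=
    smooth_radial (smooth_diffLog hq hqp)
  have h := integral_mul_laplacian ψ.smooth ψ.hasCompactSupport hL
  have h1 : ∀ ξ ∈ annulus (2 * (l + 2)), ∀ i,
      partialDeriv i (radial (2 * (l + 2)) (diffLog 8 (1 / 8))) ξ = -field i ξ := by
    intro ξ hξ i
    have h1 : 1 ≤ ‖ξ‖ ^ 2 := one_le_pow₀ hξ.1
    have h2 : ‖ξ‖ ^ 2 ≤ 4 := by nlinarith [hξ.2, hξ.1]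
    rw [partialDeriv_radial_diffLog hq hqp, logKer_one (by linarith) (by linarith),
      logKer_zero (by linarith)]
    ring
  have h2 : ∀ ξ ∈ annulus (2 * (l + 2)),
      Δ (radial (2 * (l + 2)) (diffLog 8 (1 / 8))) ξ = -((2 * l + 2) / ‖ξ‖ ^ 2) := by
    intro ξ hξ
    have h1 : 1 ≤ ‖ξ‖ ^ 2 := one_le_pow₀ hξ.1
    have h2 : ‖ξ‖ ^ 2 ≤ 4 := by nlinarith [hξ.2, hξ.1]
    have h3 := radIter_diffLog (n := 2 * (l + 2)) hq (by norm_num : (0 : ℝ) < 8) 1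
      (s := ‖ξ‖ ^ 2) (by linarith)
    rw [radIter_cutLog_zero 1 (show (2 : ℝ) < 8 * ‖ξ‖ ^ 2 by linarith),
      radIter_cutLog_log l 0 (by omega)
        (show 1 / 8 * ‖ξ‖ ^ 2 ∈ Ioo (0 : ℝ) 1 by constructor <;> linarith)] at h3
    have h4 : radIter (2 * (l + 2)) 1 (diffLog 8 (1 / 8)) (‖ξ‖ ^ 2) =
      -(radOp (2 * (l + 2)) (diffLog 8 (1 / 8)) (‖ξ‖ ^ 2)) := rfl
    rw [h4] at h3
    rw [laplacian_radial (smooth_diffLog hq hqp), radial, ← neg_eq_iff_eq_neg, h3]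
    have h5 : ‖ξ‖ ^ 2 ≠ 0 := by linarith
    simp
    field_simp
  rw [ψ.integral_mul_eq] at h
  simp only [ψ.integral_partialDeriv_mul_eq] at h
  have e1 : ∫ ξ in annulus (2 * (l + 2)), ψ.toFun ξ *
      Δ (radial (2 * (l + 2)) (diffLog 8 (1 / 8))) ξ =
      -((2 * l + 2) * ∫ ξ in annulus (2 * (l + 2)), ψ.toFun ξ / ‖ξ‖ ^ 2) := by
    rw [← integral_const_mul, ← integral_neg]
    refine setIntegral_congr_fun measurableSet_annulus fun ξ hξ => ?_
    simp only [h2 ξ hξ]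
    ring
  have e2 : ∀ i, ∫ ξ in annulus (2 * (l + 2)), partialDeriv i ψ.toFun ξ *
      partialDeriv i (radial (2 * (l + 2)) (diffLog 8 (1 / 8))) ξ =
      -∫ ξ in annulus (2 * (l + 2)), partialDeriv i ψ.toFun ξ * field i ξ := by
    intro i
    rw [← integral_neg]
    refine setIntegral_congr_fun measurableSet_annulus fun ξ hξ => ?_
    simp only [h1 ξ hξ]
    ring
  rw [e1] at h
  simp only [e2, Finset.sum_neg_distrib, neg_neg] at h
  exact h.symm

theorem partialDeriv_rescale_eq_deviation (hu : ContDiff ℝ ∞ u) (α R : ℝ) (i : Fin (2 * (l + 2)))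
    (ξ : EuclideanSpace ℝ (Fin (2 * (l + 2)))) :
    partialDeriv i (rescale u 0 R) ξ = deviation u α R i ξ - α * field i ξ := by
  rw [partialDeriv_rescale hu, deviation, zero_add]
  ring

/-- The Laplacian is integrated by parts onto ψ, leaving terms linear and quadratic in ∇u_R, both
continuous under L² convergence. For the limit -α log ‖ξ‖ they give -α(n-2) and α²(n-2)/2 times ∫
ψ/‖ξ‖². -/
theorem AnnularBump.tendsto_integral_confLap (ψ : AnnularBump (2 * (l + 2)))
    (hu : ContDiff ℝ ∞ u) {α : ℝ}
    (hlim : ∀ i, Tendsto (fun R => ∫ ξ in annulus (2 * (l + 2)), deviation u α R i ξ ^ 2)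
      atTop (𝓝 0)) :
    Tendsto (fun R => ∫ ξ, ψ.toFun ξ * confLap (rescale u 0 R) ξ) atTop
      (𝓝 ((l + 1) * (α * (α - 2)) * ∫ ξ in annulus (2 * (l + 2)), ψ.toFun ξ / ‖ξ‖ ^ 2)) := by
  have hdc := fun i R => continuousOn_deviation hu α R i
  have hψc := ψ.smooth.continuous.continuousOn (s := annulus (2 * (l + 2)))
  have hψd := fun i => (continuous_partialDeriv ψ.smooth i).continuousOn
    (s := annulus (2 * (l + 2)))
  have t1 : ∀ i, Tendsto (fun R => ∫ ξ in annulus (2 * (l + 2)),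
      partialDeriv i ψ.toFun ξ * partialDeriv i (rescale u 0 R) ξ) atTop
      (𝓝 (-(α * ∫ ξ in annulus (2 * (l + 2)), partialDeriv i ψ.toFun ξ * field i ξ))) := by
    intro i
    have h := tendsto_setIntegral_mul (hdc i) (hlim i) (hψd i)
    have h2 := h.sub_const (α * ∫ ξ in annulus (2 * (l + 2)), partialDeriv i ψ.toFun ξ * field i ξ)
    rw [zero_sub] at h2
    refine h2.congr fun R => ?_
    have e := integral_sub (integrableOn_annulus ((hψd i).mul (hdc i R)))
      ((integrableOn_annulus ((hψd i).mul (continuousOn_field i))).const_mul α)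
    simp only [Pi.mul_apply] at e
    rw [← integral_const_mul, ← e]
    refine integral_congr_ae (Eventually.of_forall fun ξ => ?_)
    simp only [partialDeriv_rescale_eq_deviation hu α]
    ring
  have t2 : ∀ i, Tendsto (fun R => ∫ ξ in annulus (2 * (l + 2)),
      ψ.toFun ξ * partialDeriv i (rescale u 0 R) ξ ^ 2) atTop
      (𝓝 (α ^ 2 * ∫ ξ in annulus (2 * (l + 2)), ψ.toFun ξ * field i ξ ^ 2)) := by
    intro i
    have h := tendsto_setIntegral_mul (hdc i) (hlim i) (hψc.mul (continuousOn_field i))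
    have h' := tendsto_setIntegral_mul_sq (hdc i) (hlim i) ψ.smooth.continuous ψ.nonneg ψ.le_one
    have h2 := (h'.sub (h.const_mul (2 * α))).add_const
      (α ^ 2 * ∫ ξ in annulus (2 * (l + 2)), ψ.toFun ξ * field i ξ ^ 2)
    rw [mul_zero, sub_zero, zero_add] at h2
    refine h2.congr fun R => ?_
    have i1 := integrableOn_annulus (hψc.mul ((hdc i R).pow 2))
    have i2 := integrableOn_annulus ((hψc.mul (continuousOn_field i)).mul (hdc i R))
    have i3 := integrableOn_annulus (hψc.mul ((continuousOn_field i).pow 2))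
    have e1 := integral_sub i1 (i2.const_mul (2 * α))
    have e2 := integral_add (i1.sub (i2.const_mul (2 * α))) (i3.const_mul (α ^ 2))
    simp only [Pi.mul_apply, Pi.pow_apply, Pi.sub_apply] at e1 e2 ⊢
    rw [← integral_const_mul, ← integral_const_mul, ← e1, ← e2]
    refine integral_congr_ae (Eventually.of_forall fun ξ => ?_)
    simp only [partialDeriv_rescale_eq_deviation hu α]
    ring
  have t3 := ((tendsto_finsetSum Finset.univ fun i _ => t1 i).neg).add
    ((tendsto_finsetSum Finset.univ fun i _ => t2 i).const_mul ((l : ℝ) + 1))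
  have hval : -(∑ i, -(α * ∫ ξ in annulus (2 * (l + 2)), partialDeriv i ψ.toFun ξ * field i ξ)) +
      ((l : ℝ) + 1) * ∑ i, α ^ 2 * ∫ ξ in annulus (2 * (l + 2)), ψ.toFun ξ * field i ξ ^ 2 =
      (l + 1) * (α * (α - 2)) * ∫ ξ in annulus (2 * (l + 2)), ψ.toFun ξ / ‖ξ‖ ^ 2 := by
    have e : ∑ i, ∫ ξ in annulus (2 * (l + 2)), ψ.toFun ξ * field i ξ ^ 2 =
        ∫ ξ in annulus (2 * (l + 2)), ψ.toFun ξ / ‖ξ‖ ^ 2 := by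
      have e0 := integral_finsetSum Finset.univ fun i _ =>
        integrableOn_annulus (hψc.mul ((continuousOn_field i).pow 2))
      simp only [Pi.mul_apply, Pi.pow_apply] at e0
      rw [← e0]
      refine setIntegral_congr_fun measurableSet_annulus fun ξ hξ => ?_
      rw [← Finset.mul_sum, sum_field_sq (ne_zero_of_mem_annulus hξ)]
      ring
    rw [Finset.sum_neg_distrib, ← Finset.mul_sum, ← Finset.mul_sum, e,
      ψ.sum_integral_partialDeriv_mul_field]
    ring
  rw [hval] at t3
  refine t3.congr fun R => ?_
  have hw := rescale_smooth hu 0 R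
  have h1 := integral_mul_laplacian ψ.smooth ψ.hasCompactSupport hw
  have i1 := ψ.integrable_mul (smooth_laplacian hw).continuous
  have i2 := ψ.integrable_mul (continuous_gradSq hw)
  have h2 : ∫ ξ, ψ.toFun ξ * gradSq (rescale u 0 R) ξ = ∑ i, ∫ ξ in annulus (2 * (l + 2)),
      ψ.toFun ξ * partialDeriv i (rescale u 0 R) ξ ^ 2 := by
    simp only [gradSq, Finset.mul_sum]
    have e0 := integral_finsetSum Finset.univ fun i _ =>
      ψ.integrable_mul ((continuous_partialDeriv hw i).pow 2)
    simp only [Pi.pow_apply] at e0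
    rw [e0]
    exact Finset.sum_congr rfl fun i _ => ψ.integral_mul_eq _
  simp only [ψ.integral_partialDeriv_mul_eq] at h1
  rw [← h1, ← h2, ← integral_const_mul, ← integral_add i1 (i2.const_mul _)]
  refine integral_congr_ae (Eventually.of_forall fun ξ => ?_)
  simp only [confLap]
  push_cast
  ring

/-- After a change of variables the dilated annulus R ≤ ‖y‖ ≤ 2R eventually misses every fixed y;
|g| dominates. -/
theorem tendsto_setIntegral_rescale {g : EuclideanSpace ℝ (Fin n) → ℝ} (hg : Integrable g) :
    Tendsto (fun R : ℝ => ∫ ξ in annulus n, R ^ n * g (R • ξ)) atTop (𝓝 0) := by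
  have h : Tendsto (fun R : ℝ => ∫ y, (annulus n).indicator (fun _ => (1 : ℝ)) (R⁻¹ • y) * g y)
      atTop (𝓝 0) := by
    rw [← integral_zero (EuclideanSpace ℝ (Fin n)) ℝ]
    have hm : Measurable ((annulus n).indicator fun _ => (1 : ℝ)) :=
      measurable_const.indicator measurableSet_annulus
    refine tendsto_integral_filter_of_dominated_convergence (fun y => |g y|) ?_ ?_ hg.abs ?_
    · exact Eventually.of_forall fun R =>
        (hm.comp (measurable_const_smul R⁻¹)).aestronglyMeasurable.mul hg.aestronglyMeasurable
    · refine Eventually.of_forall fun R => Eventually.of_forall fun y => ?_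
      rw [norm_mul]
      refine mul_le_of_le_one_left (abs_nonneg _) ?_
      by_cases h : R⁻¹ • y ∈ annulus n <;> simp [h]
    · refine Eventually.of_forall fun y => tendsto_const_nhds.congr' ?_
      filter_upwards [eventually_gt_atTop ‖y‖, eventually_gt_atTop 0] with R hR hR0
      rw [indicator_of_notMem, zero_mul]
      intro hmem
      have := hmem.1
      rw [norm_smul, norm_inv, Real.norm_eq_abs, abs_of_pos hR0, ← div_eq_inv_mul,
        le_div_iff₀ hR0] at this
      linarith
  refine h.congr' ?_
  filter_upwards [eventually_gt_atTop 0] with R hR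
  rw [← integral_comp_affine _ 0 hR, ← integral_indicator measurableSet_annulus]
  refine integral_congr_ae (Eventually.of_forall fun ξ => ?_)
  simp only [zero_add, smul_smul, inv_mul_cancel₀ hR.ne', one_smul]
  by_cases h : ξ ∈ annulus n <;> simp [h]

/-- Vanishing of the L^{n/2} mass is converted to L¹ against ψ by the elementary inequality t ≤ ε +
ε^{-(l+1)} t^{l+2}. -/
theorem AnnularBump.tendsto_integral_rescale (ψ : AnnularBump (2 * (l + 2)))
    {F : EuclideanSpace ℝ (Fin (2 * (l + 2))) → ℝ} (hFc : Continuous F) (hF0 : ∀ z, 0 ≤ F z)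
    (hF : Integrable (fun z => F z ^ (l + 2))) :
    Tendsto (fun R : ℝ => ∫ ξ, ψ.toFun ξ * (R ^ 2 * F (R • ξ))) atTop (𝓝 0) := by
  have ht := tendsto_setIntegral_rescale hF
  have hψ := ψ.integral_pos
  rw [Metric.tendsto_atTop']
  intro η hη
  -- Makes the contribution ε ∫ ψ equal to η/2.
  set ε := η / (2 * ∫ ξ, ψ.toFun ξ) with hε
  have hε0 : 0 < ε := by positivity
  have hlim : Tendsto (fun R : ℝ => ε * (∫ ξ, ψ.toFun ξ) + (ε⁻¹) ^ (l + 1) *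
      ∫ ξ in annulus (2 * (l + 2)), R ^ (2 * (l + 2)) * F (R • ξ) ^ (l + 2)) atTop
      (𝓝 (ε * (∫ ξ, ψ.toFun ξ) + (ε⁻¹) ^ (l + 1) * 0)) := (ht.const_mul _).const_add _
  have hlt : ε * (∫ ξ, ψ.toFun ξ) + (ε⁻¹) ^ (l + 1) * 0 < η := by
    have : ε * (∫ ξ, ψ.toFun ξ) = η / 2 := by rw [hε]; field_simp
    rw [this]
    linarith
  obtain ⟨N, hN⟩ := eventually_atTop.1 (hlim.eventually_lt_const hlt)
  refine ⟨N, fun R hR => ?_⟩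
  have hRF : Continuous fun ξ => R ^ 2 * F (R • ξ) :=
    continuous_const.mul (hFc.comp (continuous_const_smul R))
  rw [Real.dist_0_eq_abs, abs_of_nonneg (integral_nonneg fun ξ =>
    mul_nonneg (ψ.nonneg ξ) (mul_nonneg (sq_nonneg _) (hF0 _)))]
  refine lt_of_le_of_lt ?_ (hN R hR.le)
  have hRn : ∀ ξ, R ^ (2 * (l + 2)) * F (R • ξ) ^ (l + 2) = (R ^ 2 * F (R • ξ)) ^ (l + 2) := by
    intro ξ
    rw [mul_pow, pow_mul]
  simp only [hRn]
  have i3 : IntegrableOn (fun ξ => (R ^ 2 * F (R • ξ)) ^ (l + 2)) (annulus (2 * (l + 2))) :=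
    integrableOn_annulus (hRF.pow (l + 2)).continuousOn
  rw [ψ.integral_mul_eq, ψ.integral_eq, ← integral_const_mul, ← integral_const_mul,
    ← integral_add (ψ.integrable.integrableOn.const_mul ε) (i3.const_mul _)]
  refine integral_mono (ψ.integrable_mul hRF).integrableOn
    ((ψ.integrable.integrableOn.const_mul ε).add (i3.const_mul _)) fun ξ => ?_
  set t := R ^ 2 * F (R • ξ) with ht'
  have ht0 : 0 ≤ t := mul_nonneg (sq_nonneg _) (hF0 _)
  have hy : t ≤ ε + (ε⁻¹) ^ (l + 1) * t ^ (l + 2) := by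
    rcases le_or_gt t ε with h | h
    · have : 0 ≤ (ε⁻¹) ^ (l + 1) * t ^ (l + 2) := by positivity
      linarith
    · have h1 : 1 ≤ (ε⁻¹ * t) ^ (l + 1) := one_le_pow₀ (by
        rw [← div_eq_inv_mul, le_div_iff₀ hε0]; linarith)
      have h2 : (ε⁻¹) ^ (l + 1) * t ^ (l + 2) = (ε⁻¹ * t) ^ (l + 1) * t := by
        rw [mul_pow]; ring
      rw [h2]
      nlinarith
  have h3 := mul_le_mul_of_nonneg_left hy (ψ.nonneg ξ)
  have h4 := mul_le_of_le_one_left (by positivity : 0 ≤ (ε⁻¹) ^ (l + 1) * t ^ (l + 2)) (ψ.le_one ξ)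
  change ψ.toFun ξ * t ≤ ε * ψ.toFun ξ + (ε⁻¹) ^ (l + 1) * t ^ (l + 2)
  linarith

end BlowDown

/-! ### Admissible total Q-curvature and the finite-volume case -/

section TotalCurvature

variable {n l : ℕ} {u : EuclideanSpace ℝ (Fin (2 * (l + 2))) → ℝ}

/-- Pass to the limit in ∫ ψ K(u_R) ≤ ∫ ψ K⁺(u_R): the left side has the sign of α(α - 2), the right
side tends to 0. -/
theorem mul_sub_two_nonpos (hu : ContDiff ℝ ∞ u)
    (hF : Integrable (fun z => (max (confLap u z) 0) ^ (l + 2)))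
    (hf : Integrable (iterLap (l + 2) u)) {α : ℝ}
    (hα : α = (∫ y, iterLap (l + 2) u y) / kappa (2 * (l + 2))) : α * (α - 2) ≤ 0 := by
  obtain ⟨ψ⟩ := exists_annularBump (n := 2 * (l + 2)) (by omega)
  have h1 := ψ.tendsto_integral_confLap hu (α := α) fun i => by
    rw [hα]; exact tendsto_integral_sq_deviation hu hF hf i
  have hc := (continuous_confLap hu).max (continuous_const (y := (0 : ℝ)))
  have h2 := ψ.tendsto_integral_rescale hc (fun z => le_max_right _ _) hF
  have h3 := le_of_tendsto_of_tendsto' h1 h2 fun R => by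
    refine integral_mono (ψ.integrable_mul (continuous_confLap (rescale_smooth hu 0 R)))
      (ψ.integrable_mul (continuous_const.mul (hc.comp (continuous_const_smul R)))) fun ξ => ?_
    simp only [confLap_rescale hu, zero_add]
    exact mul_le_mul_of_nonneg_left (mul_le_mul_of_nonneg_left (le_max_left _ _) (sq_nonneg R))
      (ψ.nonneg ξ)
  have hI := ψ.integral_div_pos
  by_contra h
  have h4 : 0 < ((l : ℝ) + 1) * (α * (α - 2)) := mul_pos (by positivity) (not_le.1 h)
  nlinarith [mul_pos h4 hI]

theorem integrable_max_of_integrable_abs {K : EuclideanSpace ℝ (Fin n) → ℝ} (hK : Continuous K)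
    {m : ℕ} (h : Integrable (fun z => |K z| ^ m)) : Integrable (fun z => (max (K z) 0) ^ m) := by
  refine h.mono' ((hK.max continuous_const).pow m).aestronglyMeasurable
    (Eventually.of_forall fun z => ?_)
  rw [norm_pow, Real.norm_eq_abs, abs_of_nonneg (le_max_right _ _)]
  exact pow_le_pow_left₀ (le_max_right _ _) (max_le (le_abs_self _) (abs_nonneg _)) m

/-- With |K| in L^{n/2}, the whole integral ∫ ψ K(u_R) tends to 0, so its computed limit must
vanish. -/
theorem mul_sub_two_eq_zero (hu : ContDiff ℝ ∞ u)
    (hK : Integrable (fun z => |confLap u z| ^ (l + 2)))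
    (hf : Integrable (iterLap (l + 2) u)) {α : ℝ}
    (hα : α = (∫ y, iterLap (l + 2) u y) / kappa (2 * (l + 2))) : α * (α - 2) = 0 := by
  obtain ⟨ψ⟩ := exists_annularBump (n := 2 * (l + 2)) (by omega)
  have hF := integrable_max_of_integrable_abs (continuous_confLap hu) hK
  have h1 := ψ.tendsto_integral_confLap hu (α := α) fun i => by
    rw [hα]; exact tendsto_integral_sq_deviation hu hF hf i
  have h2 := ψ.tendsto_integral_rescale (continuous_confLap hu).abs (fun z => abs_nonneg _) hK
  have h3 : Tendsto (fun R => ∫ ξ, ψ.toFun ξ * confLap (rescale u 0 R) ξ) atTop (𝓝 0) := by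
    refine squeeze_zero_norm (fun R => ?_) h2
    refine (norm_integral_le_integral_norm _).trans_eq (integral_congr_ae
      (Eventually.of_forall fun ξ => ?_))
    simp only [confLap_rescale hu, zero_add, norm_mul, Real.norm_eq_abs,
      abs_of_nonneg (ψ.nonneg ξ), abs_pow, sq_abs]
  have h4 := tendsto_nhds_unique h1 h3
  have hI := ψ.integral_div_pos.ne'
  have hl : ((l : ℝ) + 1) ≠ 0 := by positivity
  simpa [hI, hl] using h4

theorem fderiv_eq_sum {v : EuclideanSpace ℝ (Fin n) → ℝ} (x ξ : EuclideanSpace ℝ (Fin n)) :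
    fderiv ℝ v x ξ = ∑ i, ξ i * partialDeriv i v x := by
  have h : ξ = ∑ i, ξ i • EuclideanSpace.single i (1 : ℝ) := by
    ext j
    simp [Finset.sum_apply, Pi.single_apply]
  conv_lhs => rw [h]
  simp [partialDeriv]

theorem AnnularBump.hasDerivAt_integral (ψ : AnnularBump n) {v : EuclideanSpace ℝ (Fin n) → ℝ}
    (hv : ContDiff ℝ ∞ v) (R₀ : ℝ) :
    HasDerivAt (fun R : ℝ => ∫ ξ, ψ.toFun ξ * v (R • ξ))
      (∫ ξ, ψ.toFun ξ * ∑ i, ξ i * partialDeriv i v (R₀ • ξ)) R₀ := by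
  have hcont : Continuous fun p : ℝ × EuclideanSpace ℝ (Fin n) =>
      ∑ i, p.2 i * partialDeriv i v (p.1 • p.2) := by
    refine continuous_finsetSum _ fun i _ => ?_
    exact ((differentiable_coord i).continuous.comp continuous_snd).mul
      ((continuous_partialDeriv hv i).comp (continuous_fst.smul continuous_snd))
  obtain ⟨C, hC⟩ := ((isCompact_closedBall R₀ 1).prod
    (isCompact_annulus (n := n))).exists_bound_of_continuousOn hcont.continuousOn
  have hcR : ∀ R : ℝ, Continuous fun ξ : EuclideanSpace ℝ (Fin n) =>
      ∑ i, ξ i * partialDeriv i v (R • ξ) := fun R =>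
    hcont.comp (by fun_prop : Continuous fun ξ : EuclideanSpace ℝ (Fin n) => (R, ξ))
  have hvR : ∀ R : ℝ, Continuous fun ξ : EuclideanSpace ℝ (Fin n) => v (R • ξ) := fun R =>
    hv.continuous.comp (continuous_const_smul R)
  refine (hasDerivAt_integral_of_dominated_loc_of_deriv_le (bound := fun ξ => ψ.toFun ξ * C)
    (F := fun R ξ => ψ.toFun ξ * v (R • ξ))
    (F' := fun R ξ => ψ.toFun ξ * ∑ i, ξ i * partialDeriv i v (R • ξ))
    (Metric.closedBall_mem_nhds R₀ one_pos)
    (Eventually.of_forall fun R => (ψ.integrable_mul (hvR R)).aestronglyMeasurable)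
    (ψ.integrable_mul (hvR R₀)) (ψ.integrable_mul (hcR R₀)).aestronglyMeasurable ?_
    (ψ.integrable.mul_const C) ?_).2
  · refine Eventually.of_forall fun ξ R hR => ?_
    by_cases h : ξ ∈ annulus n
    · rw [norm_mul, Real.norm_eq_abs, abs_of_nonneg (ψ.nonneg ξ)]
      exact mul_le_mul_of_nonneg_left (hC (R, ξ) ⟨hR, h⟩) (ψ.nonneg ξ)
    · simp [ψ.eq_zero h]
  · refine Eventually.of_forall fun ξ R _ => ?_
    have h1 : HasDerivAt (fun R : ℝ => R • ξ) ξ R := by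
      simpa using (hasDerivAt_id R).smul_const ξ
    have h2 := ((hv.differentiable (by simp) (R • ξ)).hasFDerivAt.comp_hasDerivAt R h1).const_mul
      (ψ.toFun ξ)
    rw [fderiv_eq_sum] at h2
    exact h2

/-- For α = 0 the rescaled gradient itself tends to 0 in L²; this is R J'(R) → 0 for the bump
average J(R) = ∫ ψ(ξ) u(Rξ) dξ. -/
theorem AnnularBump.tendsto_mul_deriv (ψ : AnnularBump (2 * (l + 2))) (hu : ContDiff ℝ ∞ u)
    (hlim : ∀ i, Tendsto (fun R => ∫ ξ in annulus (2 * (l + 2)), deviation u 0 R i ξ ^ 2)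
      atTop (𝓝 0)) :
    Tendsto (fun R => R * ∫ ξ, ψ.toFun ξ * ∑ i, ξ i * partialDeriv i u (R • ξ)) atTop (𝓝 0) := by
  have hψc : ∀ i, ContinuousOn (fun ξ => ψ.toFun ξ * ξ i) (annulus (2 * (l + 2))) := fun i =>
    (ψ.smooth.continuous.mul (differentiable_coord i).continuous).continuousOn
  have h := tendsto_finsetSum Finset.univ fun i _ =>
    tendsto_setIntegral_mul (fun R => continuousOn_deviation hu 0 R i) (hlim i) (hψc i)
  simp only [Finset.sum_const_zero] at h
  refine h.congr fun R => ?_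
  rw [← integral_finsetSum _ fun i _ => by
      exact integrableOn_annulus ((hψc i).mul (continuousOn_deviation hu 0 R i)),
    ψ.integral_mul_eq, ← integral_const_mul]
  refine integral_congr_ae (Eventually.of_forall fun ξ => ?_)
  simp only [deviation, Finset.mul_sum]
  exact Finset.sum_congr rfl fun i _ => by ring

/-- The average of `u (R ξ)` against a bump controls the volume from below. -/
theorem AnnularBump.exp_average_le (ψ : AnnularBump n) {v : EuclideanSpace ℝ (Fin n) → ℝ}
    (hv : Continuous v) (hi : Integrable fun x => Real.exp (v x)) {R : ℝ} (hR : 0 < R) :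
    R ^ n * ((∫ ξ, ψ.toFun ξ) *
      Real.exp ((∫ ξ, ψ.toFun ξ * v (R • ξ)) / ∫ ξ, ψ.toFun ξ)) ≤ ∫ x, Real.exp (v x) := by
  have hs := ψ.integral_pos
  set s := ∫ ξ, ψ.toFun ξ with hsd
  set c := (∫ ξ, ψ.toFun ξ * v (R • ξ)) / s with hc
  have hvR : Continuous fun ξ => v (R • ξ) := hv.comp (continuous_const_smul R)
  have i1 := ψ.integrable_mul hvR
  have h1 : s * Real.exp c ≤ ∫ ξ, ψ.toFun ξ * Real.exp (v (R • ξ)) := by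
    -- Jensen by the tangent line of exp at the weighted mean c: integrated against ψ, its linear
    -- part drops out.
    have h2 : ∫ ξ, (Real.exp c * (1 - c) * ψ.toFun ξ + Real.exp c * (ψ.toFun ξ * v (R • ξ))) =
        s * Real.exp c := by
      rw [integral_add (ψ.integrable.const_mul _) (i1.const_mul _), integral_const_mul,
        integral_const_mul, ← hsd]
      have : ∫ ξ, ψ.toFun ξ * v (R • ξ) = c * s := by rw [hc]; field_simp
      rw [this]
      ring
    rw [← h2]
    refine integral_mono ((ψ.integrable.const_mul _).add (i1.const_mul _))
      (ψ.integrable_mul (Real.continuous_exp.comp hvR)) fun ξ => ?_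
    have h3 := Real.add_one_le_exp (v (R • ξ) - c)
    have h4 : Real.exp c * (v (R • ξ) - c + 1) ≤ Real.exp (v (R • ξ)) := by
      calc _ ≤ Real.exp c * Real.exp (v (R • ξ) - c) := by gcongr
        _ = _ := by rw [← Real.exp_add]; ring_nf
    have h5 := mul_le_mul_of_nonneg_left h4 (ψ.nonneg ξ)
    change Real.exp c * (1 - c) * ψ.toFun ξ + Real.exp c * (ψ.toFun ξ * v (R • ξ)) ≤
      ψ.toFun ξ * Real.exp (v (R • ξ))
    linarith
  have h6 := integrable_comp_affine hi 0 hR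
  have h7 := integral_comp_affine (fun x => Real.exp (v x)) 0 hR
  rw [← h7]
  calc R ^ n * (s * Real.exp c) ≤ R ^ n * ∫ ξ, ψ.toFun ξ * Real.exp (v (R • ξ)) := by gcongr
    _ = ∫ ξ, R ^ n * (ψ.toFun ξ * Real.exp (v (R • ξ))) := by rw [integral_const_mul]
    _ ≤ _ := by
      refine integral_mono ((ψ.integrable_mul (Real.continuous_exp.comp hvR)).const_mul _) h6
        fun ξ => ?_
      simp only [zero_add]
      refine mul_le_mul_of_nonneg_left ?_ (by positivity)
      exact mul_le_of_le_one_left (Real.exp_pos _).le (ψ.le_one ξ)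

/-- Since R J'(R) → 0, J loses at most (s/2) log R, with s = ∫ ψ. The volume bound Rⁿ s exp(nJ(R)/s)
then grows at least like R^{n/2}. -/
theorem not_integrable_exp (hu : ContDiff ℝ ∞ u)
    (hlim : ∀ i, Tendsto (fun R => ∫ ξ in annulus (2 * (l + 2)), deviation u 0 R i ξ ^ 2)
      atTop (𝓝 0)) :
    ¬ Integrable (fun x => Real.exp (((2 * (l + 2) : ℕ) : ℝ) * u x)) := by
  intro hi
  obtain ⟨ψ⟩ := exists_annularBump (n := 2 * (l + 2)) (by omega)
  have hs := ψ.integral_pos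
  set s := ∫ ξ, ψ.toFun ξ with hsd
  set N : ℝ := ((2 * (l + 2) : ℕ) : ℝ) with hN
  have hN0 : 0 < N := by rw [hN]; positivity
  set J : ℝ → ℝ := fun R => ∫ ξ, ψ.toFun ξ * u (R • ξ) with hJ
  have hJd : ∀ R, HasDerivAt J (∫ ξ, ψ.toFun ξ * ∑ i, ξ i * partialDeriv i u (R • ξ)) R :=
    fun R => ψ.hasDerivAt_integral hu R
  -- Any threshold strictly between -s and 0 would leave a positive power of R.
  have hev := (ψ.tendsto_mul_deriv hu hlim).eventually_const_lt (by linarith : -(s / 2) < 0)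
  obtain ⟨R₀, hR₀⟩ := eventually_atTop.1 (hev.and (eventually_gt_atTop 0))
  have hpos : ∀ R, R₀ ≤ R → 0 < R := fun R hR => (hR₀ R hR).2
  have hd : ∀ R, R₀ ≤ R → HasDerivAt (fun R => J R + s / 2 * Real.log R)
      ((∫ ξ, ψ.toFun ξ * ∑ i, ξ i * partialDeriv i u (R • ξ)) + s / 2 * R⁻¹) R := fun R hR =>
    (hJd R).add ((Real.hasDerivAt_log (hpos R hR).ne').const_mul _)
  have hmono : MonotoneOn (fun R => J R + s / 2 * Real.log R) (Ici R₀) := by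
    refine monotoneOn_of_deriv_nonneg (convex_Ici R₀)
      (fun R hR => (hd R hR).continuousAt.continuousWithinAt)
      (fun R hR => (hd R (interior_subset hR)).differentiableAt.differentiableWithinAt)
      fun R hR => ?_
    have hR' : R₀ ≤ R := interior_subset hR
    rw [(hd R hR').deriv]
    have h1 := (hR₀ R hR').1
    have h0 := hpos R hR'
    have h2 : (∫ ξ, ψ.toFun ξ * ∑ i, ξ i * partialDeriv i u (R • ξ)) + s / 2 * R⁻¹ =
        R⁻¹ * (R * (∫ ξ, ψ.toFun ξ * ∑ i, ξ i * partialDeriv i u (R • ξ)) + s / 2) := by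
      field_simp
    rw [h2]
    have : 0 < R⁻¹ := by positivity
    exact mul_nonneg this.le (by linarith)
  set c := J R₀ + s / 2 * Real.log R₀ with hc
  have hlow : ∀ R, R₀ ≤ R →
      s * Real.exp (N * (1 / 2 * Real.log R + c / s)) ≤ ∫ x, Real.exp (N * u x) := by
    intro R hR
    have h0 := hpos R hR
    have h1 := ψ.exp_average_le (v := fun x => N * u x) (continuous_const.mul hu.continuous) hi h0
    refine le_trans ?_ h1
    have h2 : ∫ ξ, ψ.toFun ξ * (N * u (R • ξ)) = N * J R := by
      rw [hJ, ← integral_const_mul]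
      exact integral_congr_ae (Eventually.of_forall fun ξ => by ring)
    have h3 : R ^ (2 * (l + 2)) = Real.exp (N * Real.log R) := by
      rw [hN, Real.exp_nat_mul, Real.exp_log h0]
    have h4 : c ≤ J R + s / 2 * Real.log R := hmono self_mem_Ici hR hR
    rw [h2, h3, ← hsd, mul_left_comm, ← Real.exp_add]
    refine mul_le_mul_of_nonneg_left (Real.exp_le_exp.2 ?_) hs.le
    have h5 : c / s ≤ J R / s + 1 / 2 * Real.log R := by
      rw [div_le_iff₀ hs]
      have : (J R / s + 1 / 2 * Real.log R) * s = J R + s / 2 * Real.log R := by field_simp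
      linarith
    calc _ ≤ N * (1 / 2 * Real.log R + (J R / s + 1 / 2 * Real.log R)) := by gcongr
      _ = _ := by ring
  have htop : Tendsto (fun R => s * Real.exp (N * (1 / 2 * Real.log R + c / s))) atTop atTop := by
    refine Tendsto.const_mul_atTop hs (Real.tendsto_exp_atTop.comp
      (Tendsto.const_mul_atTop hN0 (tendsto_atTop_add_const_right _ _
        (Tendsto.const_mul_atTop (by norm_num) Real.tendsto_log_atTop))))
  obtain ⟨R, h1, h2⟩ := ((htop.eventually_gt_atTop (∫ x, Real.exp (N * u x))).and
    (eventually_ge_atTop R₀)).exists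
  exact absurd (hlow R h2) (not_le.2 h1)

theorem qCurvature_mul_exp (x : EuclideanSpace ℝ (Fin (2 * (l + 2)))) :
    qCurvature u x * Real.exp (((2 * (l + 2) : ℕ) : ℝ) * u x) = iterLap (l + 2) u x := by
  have h : 2 * (l + 2) / 2 = l + 2 := by omega
  rw [qCurvature, h, mul_assoc, ← Real.exp_add]
  simp [iterLap]

theorem exp_mul_pow (x : EuclideanSpace ℝ (Fin (2 * (l + 2)))) :
    Real.exp (-(2 * u x)) ^ (l + 2) * Real.exp (((2 * (l + 2) : ℕ) : ℝ) * u x) = 1 := by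
  rw [← Real.exp_nat_mul, ← Real.exp_add, Real.exp_eq_one_iff]
  push_cast
  ring

/-- The volume density e^{nu} cancels (e^{-2u})^{n/2}, so the hypothesis concerns K⁺ and Lebesgue
measure alone, up to the constant (2(n-1))^{n/2}. -/
theorem max_scalarCurvature_pow (hu : ContDiff ℝ ∞ u) (x : EuclideanSpace ℝ (Fin (2 * (l + 2)))) :
    (max (-(scalarCurvature (conformalMetric u) x)) 0) ^ (2 * (l + 2) / 2) *
      Real.exp (((2 * (l + 2) : ℕ) : ℝ) * u x) =
      (2 * (2 * l + 3)) ^ (l + 2) * (max (confLap u x) 0) ^ (l + 2) := by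
  have h : 2 * (l + 2) / 2 = l + 2 := by omega
  have h2 : -(scalarCurvature (conformalMetric u) x) =
      2 * (2 * l + 3) * Real.exp (-(2 * u x)) * confLap u x := by
    rw [scalarCurvature_conformalMetric hu, confLap, gradSq]
    push_cast
    ring
  have h3 : max (2 * (2 * l + 3) * Real.exp (-(2 * u x)) * confLap u x) 0 =
      2 * (2 * l + 3) * Real.exp (-(2 * u x)) * max (confLap u x) 0 := by
    rw [mul_max_of_nonneg _ _ (by positivity), mul_zero]
  rw [h, h2, h3, mul_pow, mul_pow]
  linear_combination (2 * (2 * (l : ℝ) + 3)) ^ (l + 2) * (max (confLap u x) 0) ^ (l + 2) *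
    exp_mul_pow (u := u) x

theorem abs_scalarCurvature_pow (hu : ContDiff ℝ ∞ u) (x : EuclideanSpace ℝ (Fin (2 * (l + 2)))) :
    |scalarCurvature (conformalMetric u) x| ^ (2 * (l + 2) / 2) *
      Real.exp (((2 * (l + 2) : ℕ) : ℝ) * u x) =
      (2 * (2 * l + 3)) ^ (l + 2) * |confLap u x| ^ (l + 2) := by
  have h : 2 * (l + 2) / 2 = l + 2 := by omega
  have h2 : scalarCurvature (conformalMetric u) x =
      -(2 * (2 * l + 3) * Real.exp (-(2 * u x)) * confLap u x) := by
    rw [scalarCurvature_conformalMetric hu, confLap, gradSq]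
    push_cast
    ring
  have h3 : (0 : ℝ) ≤ 2 * (2 * l + 3) * Real.exp (-(2 * u x)) := by positivity
  rw [h, h2, abs_neg, abs_mul, abs_of_nonneg h3, mul_pow, mul_pow]
  linear_combination (2 * (2 * (l : ℝ) + 3)) ^ (l + 2) * |confLap u x| ^ (l + 2) *
    exp_mul_pow (u := u) x

end TotalCurvature

end ConformalQ

theorem mainTheorem6 (n : ℕ) (hn : 4 ≤ n) (hn_even : Even n)
    (u : EuclideanSpace ℝ (Fin n) → ℝ) (hu : ContDiff ℝ ∞ u)
    (hQ : Integrable (fun x => ConformalQ.qCurvature u x * Real.exp (n * u x))) :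
    (Integrable (fun x =>
        (max (-(ConformalQ.scalarCurvature (ConformalQ.conformalMetric u) x)) 0) ^ (n / 2)
          * Real.exp (n * u x)) →
      0 ≤ ∫ x, ConformalQ.qCurvature u x * Real.exp (n * u x) ∧
      ∫ x, ConformalQ.qCurvature u x * Real.exp (n * u x)
        ≤ ((n - 1).factorial : ℝ) * ConformalQ.sphereVolume n) ∧
    (Integrable (fun x =>
        |ConformalQ.scalarCurvature (ConformalQ.conformalMetric u) x| ^ (n / 2)
          * Real.exp (n * u x)) →
      (∫ x, ConformalQ.qCurvature u x * Real.exp (n * u x) = 0 ∨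
        ∫ x, ConformalQ.qCurvature u x * Real.exp (n * u x)
          = ((n - 1).factorial : ℝ) * ConformalQ.sphereVolume n) ∧
      (Integrable (fun x => Real.exp (n * u x)) →
        ∫ x, ConformalQ.qCurvature u x * Real.exp (n * u x)
          = ((n - 1).factorial : ℝ) * ConformalQ.sphereVolume n)) := by
  obtain ⟨l, rfl⟩ : ∃ l, n = 2 * (l + 2) := by
    obtain ⟨r, hr⟩ := hn_even
    exact ⟨r - 2, by omega⟩
  have hκ := ConformalQ.kappa_pos l
  have hκ2 : ((2 * (l + 2) - 1).factorial : ℝ) * ConformalQ.sphereVolume (2 * (l + 2)) =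
      2 * ConformalQ.kappa (2 * (l + 2)) := by
    rw [ConformalQ.kappa]; ring
  have hc : IsUnit ((2 * (2 * (l : ℝ) + 3)) ^ (l + 2)) :=
    (by positivity : (2 * (2 * (l : ℝ) + 3)) ^ (l + 2) ≠ 0).isUnit
  simp only [ConformalQ.qCurvature_mul_exp, ConformalQ.max_scalarCurvature_pow hu,
    ConformalQ.abs_scalarCurvature_pow hu, integrable_const_mul_iff hc, hκ2] at hQ ⊢
  set Λ := ∫ x, ConformalQ.iterLap (l + 2) u x with hΛ
  set κ := ConformalQ.kappa (2 * (l + 2)) with hκd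
  -- With α = Λ/κ the target interval [0, 2κ] is 0 ≤ α ≤ 2, which is what α(α - 2) ≤ 0 says.
  have hΛα : Λ = Λ / κ * κ := by field_simp
  refine ⟨fun hF => ?_, fun hK => ?_⟩
  · have h := ConformalQ.mul_sub_two_nonpos hu hF hQ rfl
    rw [← hΛ, ← hκd] at h
    constructor
    · rw [hΛα]
      refine mul_nonneg ?_ hκ.le
      by_contra h0
      nlinarith
    · rw [hΛα]
      refine mul_le_mul_of_nonneg_right ?_ hκ.le
      by_contra h0
      nlinarith
  · have h := ConformalQ.mul_sub_two_eq_zero hu hK hQ rfl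
    rw [← hΛ, ← hκd] at h
    have hor : Λ = 0 ∨ Λ = 2 * κ := by
      rcases mul_eq_zero.1 h with h | h
      · left; rw [hΛα, h, zero_mul]
      · right; rw [hΛα, sub_eq_zero.1 h]
    refine ⟨hor, fun hvol => hor.resolve_left fun h0 => ?_⟩
    have hF := ConformalQ.integrable_max_of_integrable_abs (ConformalQ.continuous_confLap hu) hK
    -- Λ = 0 means α = 0, so the deviation is the rescaled gradient itself.
    refine ConformalQ.not_integrable_exp hu (fun i => ?_) hvol
    have h1 := ConformalQ.tendsto_integral_sq_deviation hu hF hQ i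
    rw [← hΛ, h0, zero_div] at h1
    exact h1
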